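/- Let $H$ be a small category and $G$ a (discrete) groupoid, both identified with their sets of morphisms, with source and target maps $\mathbf s,\mathbf t$ and unit spaces $H^{(0)},G^{(0)}$; the product $fg$ is defined iff $\mathbf s(f)=\mathbf t(g)$. Let $(\varphi,\alpha)$ be a left action of $G$ on $H$: $\varphi:H^{(0)}\to G^{(0)}$ is a surjective map, $\alpha_g(h)\in H$ is defined for all $(g,h)$ with $\mathbf s(g)=\varphi(\mathbf t(h))=\varphi(\mathbf s(h))$, and, whenever the arguments are in the domain of definition, $\alpha_g(\mathbf s(h))=\mathbf s(\alpha_g(h))$, $\alpha_g(\mathbf t(h))=\mathbf t(\alpha_g(h))$, $\varphi(\alpha_g(u))=\mathbf t(g)$ for $u\in H^{(0)}$, $\alpha_{\varphi(\mathbf t(h))}(h)=h$, $\alpha_{g'}(\alpha_g(h))=\alpha_{g'g}(h)$ and $\alpha_g(h'h)=\alpha_g(h')\alpha_g(h)$. *Semi-direct product.* $H\times_\alpha G=\{(h,g): \mathbf t(g)=\varphi(\mathbf s(h))=\varphi(\mathbf t(h))\}$ is the small category with unit space $H^{(0)}$, $\mathbf s(h,g)=\alpha_{g^{-1}}(\mathbf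 s(h))$, $\mathbf t(h,g)=\mathbf t(h)$ and $(h,g)(h',g')=(h\,\alpha_g(h'),gg')$. Let $H_r=\{h\in H:\varphi(\mathbf s(h))=\varphi(\mathbf t(h))\}$, a subcategory of $H$ on which $G$ acts by restriction of $\alpha$. *Semigroupoid C\*-algebra.* A representation of a small category $\Lambda$ in a C\*-algebra is a family of partial isometries $(T_f)_{f\in\Lambda}$ with $T_fT_g=T_{fg}$ if $fg$ is defined and $T_fT_g=0$ otherwise, such that the projections $Q_f=T_f^*T_f$, $P_f=T_fT_f^*$ ($f\in\Lambda$) all commute, $P_fP_g=0$ if $f$ and $g$ have no common multiple (that is, $fk\neq gl$ for all $k,l$), and $Q_fP_g=P_g$ if $fg$ is defined. $C^*(\Lambda)$ is the universal C\*-algebra generated by a representation $(S_f)_{f\in\Lambda}$ of $\Lambda$. *Quasi action and crossed product.* A quasi action $\beta$ of $G$ on a C\*-algebra $A$ assigns to each $g\in G$ a \*-homomorphism $\beta_g:A\to A$ and a closed \*-subalgebra $\mathcal D(\beta_g)\subseteq A$ which $\beta_g$ maps bijectively onto $\beta_g(A)$, such that $\beta_t(A)=\mathcal D(\beta_s)$,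 $\mathcal D(\beta_{st})=\mathcal D(\beta_t)$ and $\beta_{st}=\beta_s\beta_t$ if $st$ is defined, and $\beta_s\beta_t=0$ otherwise. Let $A[G]$ be the \*-algebra of finite sums $\sum_t a_t t$ with $a_t\in\mathcal D(\beta_{t^{-1}})$, where $(a\,t)(b\,u)=a\beta_t(b)\,tu$ if $tu$ is defined and $0$ otherwise, and $(a\,t)^*=\beta_{t^{-1}}(a^*)\,t^{-1}$. The crossed product $A\times_\beta G$ is the completion of $A[G]$ for the norm $\|f\|=\sup_\sigma\|\sigma(f)\|$, where $\sigma$ runs over all \*-representations of $A[G]$ on Hilbert spaces with $\|\sigma(\sum_t a_t t)\|\le\sum_t\|a_t\|$. For $g\in G$ put $H_r^g=\{h\in H_r:\mathbf s(g)=\varphi(\mathbf s(h))=\varphi(\mathbf t(h))\}$. There is a quasi action $\tilde\alpha$ of $G$ on $C^*(H_r)$ for which $\tilde\alpha_g(S_h)=S_{\alpha_g(h)}$ if $h\in H_r^g$, $\tilde\alpha_g(S_h)=0$ otherwise, and $\mathcal D(\tilde\alpha_g)$ is the closed \*-subalgebra generated by $\{S_h:h\in H_r^g\}$. **Theorem.**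 There is a \*-isomorphism $$C^*(H\times_\alpha G)\;\cong\; C^*(H_r)\times_{\tilde\alpha}G$$ which sends $S_{(h,g)}$ to $S_h\,g$ for all $(h,g)\in H\times_\alpha G$. -/

import Mathlib

open UniformSpace CategoryTheory
open scoped CStarAlgebra

universe v₁ v₂ u₁ u₂ w

set_option linter.unusedSectionVars false

noncomputable section

/-- A C*-seminorm on a complex *-algebra. -/
structure CStarSeminorm (F : Type*) [NonUnitalRing F] [StarRing F] [Module ℂ F] extends
    Seminorm ℂ F where
  mul_le' : ∀ x y, toFun (x * y) ≤ toFun x * toFun y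
  star_mul_self' : ∀ x, toFun (star x * x) = toFun x ^ 2

namespace CStarSeminorm

section Basic

variable {F : Type*} [NonUnitalRing F] [StarRing F] [Module ℂ F]

instance : CoeFun (CStarSeminorm F) (fun _ => F → ℝ) := ⟨fun p => p.toFun⟩

variable (p : CStarSeminorm F)

theorem nonneg (x : F) : 0 ≤ p x := apply_nonneg p.toSeminorm x

theorem map_zero : p 0 = 0 := _root_.map_zero p.toSeminorm

theorem map_neg (x : F) : p (-x) = p x := map_neg_eq_map p.toSeminorm x

theorem add_le (x y : F) : p (x + y) ≤ p x + p y := map_add_le_add p.toSeminorm x y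

theorem map_smul (c : ℂ) (x : F) : p (c • x) = ‖c‖ * p x := map_smul_eq_mul p.toSeminorm c x

theorem apply_star (x : F) : p (star x) = p x := by
  have key : ∀ y : F, p y ≤ p (star y) := by
    intro y
    have h1 := p.mul_le' (star y) y
    rw [p.star_mul_self'] at h1
    rcases (p.nonneg y).eq_or_lt with h | h
    · rw [← h]; exact p.nonneg _
    · nlinarith
  refine le_antisymm ?_ (key x)
  have := key (star x)
  rwa [star_star] at this

/-- The pointwise supremum of a pointwise bounded family of C*-seminorms. -/
def sup (𝒮 : Set (CStarSeminorm F)) (h : ∀ x : F, ∃ M : ℝ, ∀ p ∈ 𝒮, p x ≤ M) :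
    CStarSeminorm F :=
  have bdd : ∀ x : F, BddAbove (Set.range fun p : 𝒮 => p.1 x) := fun x => by
    obtain ⟨M, hM⟩ := h x
    exact ⟨M, by rintro _ ⟨p, rfl⟩; exact hM p.1 p.2⟩
  have nn : ∀ x : F, 0 ≤ ⨆ p : 𝒮, p.1 x := fun x => Real.iSup_nonneg fun p => p.1.nonneg x
  { toFun := fun x => ⨆ p : 𝒮, p.1 x
    map_zero' := by simp [CStarSeminorm.map_zero]
    add_le' := fun x y => Real.iSup_le (fun p => (p.1.add_le x y).trans
      (add_le_add (le_ciSup (bdd x) p) (le_ciSup (bdd y) p))) (add_nonneg (nn x) (nn y))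
    neg' := fun x => by simp [CStarSeminorm.map_neg]
    smul' := fun c x => by
      simp only [CStarSeminorm.map_smul]
      exact (Real.mul_iSup_of_nonneg (norm_nonneg c) _).symm
    mul_le' := fun x y => Real.iSup_le (fun p => (p.1.mul_le' x y).trans
      (mul_le_mul (le_ciSup (bdd x) p) (le_ciSup (bdd y) p) (p.1.nonneg y) (nn x)))
      (mul_nonneg (nn x) (nn y))
    star_mul_self' := fun x => by
      simp only [CStarSeminorm.star_mul_self']
      refine le_antisymm (Real.iSup_le (fun p => ?_) (sq_nonneg _)) ?_
      · exact pow_le_pow_left₀ (p.1.nonneg x) (le_ciSup (bdd x) p) 2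
      · have hb : BddAbove (Set.range fun p : 𝒮 => p.1 x ^ 2) := by
          obtain ⟨M, hM⟩ := h x
          exact ⟨M ^ 2, by
            rintro _ ⟨p, rfl⟩; exact pow_le_pow_left₀ (p.1.nonneg x) (hM p.1 p.2) 2⟩
        have hs : (⨆ p : 𝒮, p.1 x) ≤ √(⨆ p : 𝒮, p.1 x ^ 2) :=
          Real.iSup_le (fun p => Real.le_sqrt_of_sq_le (le_ciSup hb p)) (Real.sqrt_nonneg _)
        calc (⨆ p : 𝒮, p.1 x) ^ 2 ≤ √(⨆ p : 𝒮, p.1 x ^ 2) ^ 2 := pow_le_pow_left₀ (nn x) hs 2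
          _ = _ := Real.sq_sqrt (Real.iSup_nonneg fun p => sq_nonneg _) }

theorem le_sup {𝒮 : Set (CStarSeminorm F)} (h : ∀ x : F, ∃ M : ℝ, ∀ p ∈ 𝒮, p x ≤ M)
    {p : CStarSeminorm F} (hp : p ∈ 𝒮) (x : F) : p x ≤ sup 𝒮 h x := by
  have bdd : BddAbove (Set.range fun p : 𝒮 => p.1 x) := by
    obtain ⟨M, hM⟩ := h x
    exact ⟨M, by rintro _ ⟨p, rfl⟩; exact hM p.1 p.2⟩
  exact le_ciSup bdd ⟨p, hp⟩

theorem sup_le {𝒮 : Set (CStarSeminorm F)} (h : ∀ x : F, ∃ M : ℝ, ∀ p ∈ 𝒮, p x ≤ M)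
    {M : ℝ} (hM : 0 ≤ M) {x : F} (hx : ∀ p ∈ 𝒮, p x ≤ M) : sup 𝒮 h x ≤ M :=
  Real.iSup_le (fun p => hx p.1 p.2) hM

/-- The C*-seminorm `x ↦ ‖σ x‖` given by a *-homomorphism into a C*-algebra. -/
def ofHom {B : Type*} [NonUnitalCStarAlgebra B] (σ : F →⋆ₙₐ[ℂ] B) : CStarSeminorm F where
  toFun x := ‖σ x‖
  map_zero' := by simp
  add_le' x y := by simpa using norm_add_le (σ x) (σ y)
  neg' x := by
    have : σ (-x) = - σ x := _root_.map_neg σ x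
    rw [this, norm_neg]
  smul' c x := by rw [_root_.map_smul, norm_smul]
  mul_le' x y := by simpa using norm_mul_le (σ x) (σ y)
  star_mul_self' x := by
    rw [map_mul, StarHomClass.map_star, CStarRing.norm_star_mul_self, sq]

@[simp] theorem ofHom_apply {B : Type*} [NonUnitalCStarAlgebra B] (σ : F →⋆ₙₐ[ℂ] B) (x : F) :
    ofHom σ x = ‖σ x‖ := rfl

end Basic

section Completion

variable {F : Type*} [NonUnitalRing F] [StarRing F] [Module ℂ F] [IsScalarTower ℂ F F]
  [SMulCommClass ℂ F F] [StarModule ℂ F]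

/-- The *-algebra `F`, equipped with the C*-seminorm `p`. -/
def Carrier (_p : CStarSeminorm F) : Type _ := F

variable (p : CStarSeminorm F)

instance : NonUnitalRing p.Carrier := inferInstanceAs (NonUnitalRing F)
instance : StarRing p.Carrier := inferInstanceAs (StarRing F)
instance : Module ℂ p.Carrier := inferInstanceAs (Module ℂ F)
instance : IsScalarTower ℂ p.Carrier p.Carrier := inferInstanceAs (IsScalarTower ℂ F F)
instance : SMulCommClass ℂ p.Carrier p.Carrier := inferInstanceAs (SMulCommClass ℂ F F)
instance : StarModule ℂ p.Carrier := inferInstanceAs (StarModule ℂ F)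

instance : NonUnitalSeminormedRing p.Carrier where
  __ := (inferInstance : NonUnitalRing p.Carrier)
  __ := p.toSeminorm.toSeminormedAddCommGroup
  norm_mul_le x y := p.mul_le' x y

theorem Carrier.norm_def (x : p.Carrier) : ‖x‖ = p x := rfl

instance : NormedSpace ℂ p.Carrier where
  norm_smul_le c x := (p.map_smul c x).le

instance : NormedStarGroup p.Carrier where
  norm_star_le x := (p.apply_star x).le

/-- The C*-algebra obtained from `F` by dividing out the null space of the C*-seminorm `p` and
completing. -/
def Compl : Type _ := Completion p.Carrier

instance : NormedAddCommGroup p.Compl := inferInstanceAs (NormedAddCommGroup (Completion p.Carrier))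
instance : NormedSpace ℂ p.Compl := inferInstanceAs (NormedSpace ℂ (Completion p.Carrier))
instance : CompleteSpace p.Compl := inferInstanceAs (CompleteSpace (Completion p.Carrier))

/-- The canonical map from `F` to its completion. -/
def incl (x : F) : p.Compl := ((show p.Carrier from x : p.Carrier) : Completion p.Carrier)

theorem norm_incl (x : F) : ‖p.incl x‖ = p x := Completion.norm_coe (E := p.Carrier) x

theorem incl_add (x y : F) : p.incl (x + y) = p.incl x + p.incl y :=
  Completion.coe_add (α := p.Carrier) x y

theorem incl_zero : p.incl 0 = 0 := Completion.coe_zero (α := p.Carrier)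

theorem incl_smul (c : ℂ) (x : F) : p.incl (c • x) = c • p.incl x :=
  Completion.coe_smul (X := p.Carrier) c x

theorem denseRange_incl : DenseRange p.incl := Completion.denseRange_coe (α := p.Carrier)

theorem continuous_incl : Continuous (fun x : p.Carrier => p.incl x) :=
  Completion.continuous_coe p.Carrier

/-- Left multiplication, extended to the completion in both variables. -/
def mulCLM : p.Compl →L[ℂ] p.Compl →L[ℂ] p.Compl :=
  let toC : p.Carrier →L[ℂ] p.Compl := Completion.toComplL (𝕜 := ℂ) (E := p.Carrier)
  let m : p.Carrier →L[ℂ] p.Carrier →L[ℂ] p.Compl :=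
    (ContinuousLinearMap.compL ℂ p.Carrier p.Carrier p.Compl toC).comp
      (ContinuousLinearMap.mul ℂ p.Carrier)
  let m₁ : p.Compl →L[ℂ] p.Carrier →L[ℂ] p.Compl := m.extend toC
  (m₁.flip.extend toC).flip

theorem mulCLM_incl (x y : F) : p.mulCLM (p.incl x) (p.incl y) = p.incl (x * y) := by
  have hd : DenseRange (Completion.toComplL (𝕜 := ℂ) (E := p.Carrier)) :=
    Completion.denseRange_coe
  have hu : IsUniformInducing (Completion.toComplL (𝕜 := ℂ) (E := p.Carrier)) :=
    Completion.isUniformInducing_coe _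
  unfold mulCLM
  simp only [ContinuousLinearMap.flip_apply]
  erw [ContinuousLinearMap.extend_eq _ hd hu]
  rw [ContinuousLinearMap.flip_apply]
  erw [ContinuousLinearMap.extend_eq _ hd hu]
  rfl

instance : Mul p.Compl := ⟨fun x y => p.mulCLM x y⟩

theorem incl_mul (x y : F) : p.incl (x * y) = p.incl x * p.incl y := (p.mulCLM_incl x y).symm

instance : ContinuousMul p.Compl where
  continuous_mul := by
    change Continuous fun q : p.Compl × p.Compl => p.mulCLM q.1 q.2
    fun_prop

theorem compl_induction₁ {P : p.Compl → Prop} (hc : IsClosed {x | P x})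
    (h : ∀ x : F, P (p.incl x)) (x : p.Compl) : P x :=
  Completion.induction_on (α := p.Carrier) x hc h

theorem compl_induction₂ {P : p.Compl → p.Compl → Prop}
    (hc : IsClosed {x : p.Compl × p.Compl | P x.1 x.2})
    (h : ∀ x y : F, P (p.incl x) (p.incl y)) (x y : p.Compl) : P x y :=
  Completion.induction_on₂ (α := p.Carrier) (β := p.Carrier) x y hc h

theorem compl_induction₃ {P : p.Compl → p.Compl → p.Compl → Prop}
    (hc : IsClosed {x : p.Compl × p.Compl × p.Compl | P x.1 x.2.1 x.2.2})
    (h : ∀ x y z : F, P (p.incl x) (p.incl y) (p.incl z)) (x y z : p.Compl) : P x y z :=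
  Completion.induction_on₃ (α := p.Carrier) (β := p.Carrier) (γ := p.Carrier) x y z hc h

theorem compl_mul_assoc (x y z : p.Compl) : x * y * z = x * (y * z) :=
  p.compl_induction₃ (P := fun x y z => x * y * z = x * (y * z))
    (isClosed_eq (by fun_prop) (by fun_prop))
    (fun x y z => by rw [← incl_mul, ← incl_mul, ← incl_mul, ← incl_mul, mul_assoc]) x y z

instance : NonUnitalRing p.Compl where
  __ := (inferInstance : AddCommGroup p.Compl)
  __ := (inferInstance : Mul p.Compl)
  left_distrib x y z := (p.mulCLM x).map_add y z
  right_distrib x y z := by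
    change p.mulCLM (x + y) z = p.mulCLM x z + p.mulCLM y z
    rw [_root_.map_add]; rfl
  zero_mul x := by
    change p.mulCLM 0 x = 0
    rw [_root_.map_zero]; rfl
  mul_zero x := (p.mulCLM x).map_zero
  mul_assoc := p.compl_mul_assoc

instance : NonUnitalNormedRing p.Compl where
  __ := (inferInstance : NonUnitalRing p.Compl)
  __ := (inferInstance : NormedAddCommGroup p.Compl)
  norm_mul_le := p.compl_induction₂
    (isClosed_le (by fun_prop) (by fun_prop))
    (fun x y => by
      rw [← incl_mul, norm_incl, norm_incl, norm_incl]
      exact p.mul_le' x y)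

instance : IsScalarTower ℂ p.Compl p.Compl where
  smul_assoc c x y := by
    change p.mulCLM (c • x) y = c • p.mulCLM x y
    rw [_root_.map_smul]; rfl

instance : SMulCommClass ℂ p.Compl p.Compl where
  smul_comm c x y := ((p.mulCLM x).map_smul c y).symm

/-- The involution, extended to the completion. -/
instance : Star p.Compl := ⟨Completion.map (star : p.Carrier → p.Carrier)⟩

theorem continuous_starCompl : Continuous (star : p.Compl → p.Compl) :=
  Completion.continuous_map (α := p.Carrier) (β := p.Carrier)

theorem incl_star (x : F) : p.incl (star x) = star (p.incl x) := by
  have hu : UniformContinuous (star : p.Carrier → p.Carrier) :=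
    uniformContinuous_addMonoidHom_of_continuous
      (f := (starAddEquiv : p.Carrier ≃+ p.Carrier).toAddMonoidHom) ContinuousStar.continuous_star
  exact (Completion.map_coe hu (show p.Carrier from x)).symm

instance : StarRing p.Compl where
  star_involutive := p.compl_induction₁
    (isClosed_eq (p.continuous_starCompl.comp p.continuous_starCompl) continuous_id)
    (fun x => by rw [← incl_star, ← incl_star, star_star])
  star_mul := p.compl_induction₂
    (isClosed_eq (p.continuous_starCompl.comp continuous_mul)
      ((p.continuous_starCompl.comp continuous_snd).mul (p.continuous_starCompl.comp continuous_fst)))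
    (fun x y => by rw [← incl_mul, ← incl_star, ← incl_star, ← incl_star, ← incl_mul, star_mul])
  star_add := p.compl_induction₂
    (isClosed_eq (p.continuous_starCompl.comp continuous_add)
      ((p.continuous_starCompl.comp continuous_fst).add (p.continuous_starCompl.comp continuous_snd)))
    (fun x y => by rw [← incl_add, ← incl_star, ← incl_star, ← incl_star, ← incl_add, star_add])

instance : StarModule ℂ p.Compl where
  star_smul c := p.compl_induction₁
    (isClosed_eq (p.continuous_starCompl.comp (continuous_const_smul c))
      (p.continuous_starCompl.const_smul (star c)))
    (fun x => by rw [← incl_smul, ← incl_star, ← incl_star, ← incl_smul, star_smul])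

instance : CStarRing p.Compl where
  norm_mul_self_le := p.compl_induction₁
    (isClosed_le (continuous_norm.mul continuous_norm)
      (continuous_norm.comp (p.continuous_starCompl.mul continuous_id)))
    (fun x => by
      change ‖p.incl x‖ * ‖p.incl x‖ ≤ ‖star (p.incl x) * p.incl x‖
      rw [← incl_star, ← incl_mul, norm_incl, norm_incl, p.star_mul_self', sq])

instance : NonUnitalCStarAlgebra p.Compl where

/-- The canonical *-homomorphism from `F` to its completion. -/
def inclHom : F →⋆ₙₐ[ℂ] p.Compl where
  toFun := p.incl
  map_smul' := p.incl_smul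
  map_zero' := p.incl_zero
  map_add' := p.incl_add
  map_mul' := p.incl_mul
  map_star' := p.incl_star

@[simp] theorem inclHom_apply (x : F) : p.inclHom x = p.incl x := rfl

variable {p} {B : Type*} [NonUnitalCStarAlgebra B]

theorem compl_hom_ext {f g : p.Compl →⋆ₙₐ[ℂ] B} (h : ∀ x : F, f (p.incl x) = g (p.incl x)) :
    f = g := by
  have hf : Continuous f := map_continuous f
  have hg : Continuous g := map_continuous g
  exact DFunLike.ext _ _ (p.compl_induction₁ (isClosed_eq hf hg) h)

/-- A *-homomorphism which is contractive with respect to `p` extends to the completion. -/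
def lift (σ : F →⋆ₙₐ[ℂ] B) (h : ∀ x, ‖σ x‖ ≤ p x) : p.Compl →⋆ₙₐ[ℂ] B :=
  let σ₀ : p.Carrier →L[ℂ] B := LinearMap.mkContinuous
    { toFun := fun x => σ x
      map_add' := fun x y => _root_.map_add σ x y
      map_smul' := fun c x => _root_.map_smul σ c x } 1
      (fun x => by rw [one_mul]; exact h x)
  let E : p.Compl →L[ℂ] B := σ₀.extend (Completion.toComplL (𝕜 := ℂ) (E := p.Carrier))
  have hE : ∀ x : F, E (p.incl x) = σ x := fun x =>
    ContinuousLinearMap.extend_eq σ₀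
      (Completion.denseRange_coe : DenseRange (Completion.toComplL (𝕜 := ℂ) (E := p.Carrier)))
      (Completion.isUniformInducing_coe _) x
  { toFun := E
    map_smul' := E.map_smul
    map_zero' := E.map_zero
    map_add' := E.map_add
    map_mul' := p.compl_induction₂
      (isClosed_eq (E.continuous.comp continuous_mul)
        ((E.continuous.comp continuous_fst).mul (E.continuous.comp continuous_snd)))
      (fun x y => by rw [← incl_mul, hE, hE, hE, map_mul])
    map_star' := p.compl_induction₁
      (isClosed_eq (E.continuous.comp p.continuous_starCompl)
        (ContinuousStar.continuous_star.comp E.continuous))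
      (fun x => by
        rw [← incl_star, hE, hE, StarHomClass.map_star]) }

@[simp] theorem lift_incl (σ : F →⋆ₙₐ[ℂ] B) (h : ∀ x, ‖σ x‖ ≤ p x) (x : F) :
    lift σ h (p.incl x) = σ x :=
  ContinuousLinearMap.extend_eq (E := p.Carrier) (Eₗ := p.Compl) _
    (Completion.denseRange_coe : DenseRange (Completion.toComplL (𝕜 := ℂ) (E := p.Carrier)))
    (Completion.isUniformInducing_coe _) x

variable (p) in
theorem incl_eq_iff {x y : F} : p.incl x = p.incl y ↔ p (x - y) = 0 := by
  rw [← sub_eq_zero, ← norm_eq_zero, ← p.norm_incl]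
  have : p.incl (x - y) = p.incl x - p.incl y := _root_.map_sub p.inclHom x y
  rw [this]

theorem incl_sup_eq {𝒮 : Set (CStarSeminorm F)} (h : ∀ x : F, ∃ M : ℝ, ∀ p ∈ 𝒮, p x ≤ M)
    {x y : F} (hxy : ∀ p ∈ 𝒮, p.incl x = p.incl y) : (sup 𝒮 h).incl x = (sup 𝒮 h).incl y := by
  rw [incl_eq_iff]
  exact le_antisymm (sup_le h le_rfl fun p hp => ((p.incl_eq_iff).1 (hxy p hp)).le) (nonneg _ _)

theorem incl_ofHom_eq (σ : F →⋆ₙₐ[ℂ] B) {x y : F} (hxy : σ x = σ y) :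
    (ofHom σ).incl x = (ofHom σ).incl y := by
  rw [incl_eq_iff, ofHom_apply, map_sub, hxy, sub_self, norm_zero]

end Completion

end CStarSeminorm


/-- Words in the letters `x` (`Sum.inl x`) and `x*` (`Sum.inr x`). -/
abbrev StarWord (X : Type*) := FreeSemigroup (X ⊕ X)

/-- Reverse a word and exchange `x` with `x*`. -/
def StarWord.adj {X : Type*} (w : StarWord X) : StarWord X :=
  (FreeSemigroup.lift (fun x : X ⊕ X => MulOpposite.op (FreeSemigroup.of x.swap)) w).unop

theorem StarWord.adj_mul {X : Type*} (v w : StarWord X) : adj (v * w) = adj w * adj v := by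
  simp [adj]

theorem StarWord.adj_of {X : Type*} (x : X ⊕ X) :
    adj (FreeSemigroup.of x) = FreeSemigroup.of x.swap := by
  simp [adj]

theorem StarWord.adj_adj {X : Type*} (w : StarWord X) : adj (adj w) = w := by
  induction w using FreeSemigroup.recOnMul with
  | ih1 x => simp [adj_of]
  | ih2 x y hx hy => rw [adj_mul, adj_mul, hx, hy]

/-- The free (non-unital) complex *-algebra on a set `X`. -/
def FreeStarAlg (X : Type*) : Type _ := MonoidAlgebra ℂ (StarWord X)

namespace FreeStarAlg

variable {X : Type*}

instance : NonUnitalRing (FreeStarAlg X) := inferInstanceAs (NonUnitalRing (MonoidAlgebra ℂ _))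
instance : Module ℂ (FreeStarAlg X) := inferInstanceAs (Module ℂ (MonoidAlgebra ℂ _))
instance : IsScalarTower ℂ (FreeStarAlg X) (FreeStarAlg X) :=
  inferInstanceAs (IsScalarTower ℂ (MonoidAlgebra ℂ (StarWord X)) (MonoidAlgebra ℂ (StarWord X)))
instance : SMulCommClass ℂ (FreeStarAlg X) (FreeStarAlg X) :=
  inferInstanceAs (SMulCommClass ℂ (MonoidAlgebra ℂ (StarWord X)) (MonoidAlgebra ℂ (StarWord X)))

/-- The element `c w` for a word `w` and a scalar `c`. -/
def mono (w : StarWord X) (c : ℂ) : FreeStarAlg X := MonoidAlgebra.single w c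

theorem mono_mul_mono (v w : StarWord X) (c d : ℂ) :
    mono v c * mono w d = mono (v * w) (c * d) := MonoidAlgebra.single_mul_single v w c d

theorem smul_mono (w : StarWord X) (c d : ℂ) : c • mono w d = mono w (c * d) :=
  MonoidAlgebra.smul_single' c w d

theorem mono_add (w : StarWord X) (c d : ℂ) : mono w (c + d) = mono w c + mono w d :=
  MonoidAlgebra.single_add w c d

@[elab_as_elim]
theorem ind {P : FreeStarAlg X → Prop} (x : FreeStarAlg X) (zero : P 0)
    (add : ∀ x y, P x → P y → P (x + y)) (mono : ∀ w c, P (mono w c)) : P x :=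
  MonoidAlgebra.induction_linear (R := ℂ) (M := StarWord X) x zero add mono

/-- The involution `∑ c w ↦ ∑ c̄ w*` as an additive map. -/
def starHom : FreeStarAlg X →+ FreeStarAlg X :=
  (Finsupp.liftAddHom (M := ℂ) (N := FreeStarAlg X) fun w : StarWord X =>
    { toFun := fun c => mono w.adj (star c)
      map_zero' := by rw [star_zero]; exact MonoidAlgebra.single_zero _
      map_add' := fun c d => by rw [star_add, mono_add] }).comp
  (MonoidAlgebra.coeffAddEquiv (R := ℂ) (M := StarWord X)).toAddMonoidHom

instance : Star (FreeStarAlg X) := ⟨starHom⟩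

theorem star_mono (w : StarWord X) (c : ℂ) : star (mono w c) = mono w.adj (star c) := by
  change starHom (mono w c) = _
  exact (Finsupp.liftAddHom_apply_single _ _ _)

theorem star_add' (x y : FreeStarAlg X) : star (x + y) = star x + star y := map_add starHom x y

theorem star_zero' : star (0 : FreeStarAlg X) = 0 := map_zero starHom

instance : StarRing (FreeStarAlg X) where
  star_add := star_add'
  star_involutive x := by
    induction x using ind with
    | zero => rw [star_zero', star_zero']
    | add x y hx hy => rw [star_add', star_add', hx, hy]
    | mono w c => rw [star_mono, star_mono, StarWord.adj_adj, star_star]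
  star_mul x y := by
    induction x using ind with
    | zero => simp [star_zero']
    | add x x' hx hx' => rw [add_mul, star_add', star_add', hx, hx', mul_add]
    | mono w c =>
      induction y using ind with
      | zero => simp [star_zero']
      | add y y' hy hy' => rw [mul_add, star_add', star_add', hy, hy', add_mul]
      | mono v d =>
        rw [mono_mul_mono, star_mono, star_mono, star_mono, mono_mul_mono, StarWord.adj_mul,
          star_mul]

instance : StarModule ℂ (FreeStarAlg X) where
  star_smul c x := by
    induction x using ind with
    | zero => simp
    | add x y hx hy => rw [smul_add, star_add', star_add', hx, hy, smul_add]
    | mono w d => rw [smul_mono, star_mono, star_mono, smul_mono, star_mul, mul_comm]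

/-- The generator of the free *-algebra corresponding to `x`. -/
def gen (x : X) : FreeStarAlg X := mono (FreeSemigroup.of (Sum.inl x)) 1

theorem star_gen (x : X) : star (gen x) = mono (FreeSemigroup.of (Sum.inr x)) 1 := by
  rw [gen, star_mono, StarWord.adj_of, star_one]; rfl

variable {B : Type*} [NonUnitalRing B] [StarRing B] [Module ℂ B] [IsScalarTower ℂ B B]
  [SMulCommClass ℂ B B] [StarModule ℂ B]

/-- Evaluation of words. -/
def evalWord (T : X → B) : StarWord X →ₙ* B :=
  FreeSemigroup.lift (Sum.elim T fun x => star (T x))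

theorem evalWord_adj (T : X → B) (w : StarWord X) : evalWord T w.adj = star (evalWord T w) := by
  induction w using FreeSemigroup.recOnMul with
  | ih1 x => rcases x with x | x <;> simp [StarWord.adj_of, evalWord]
  | ih2 x y hx hy => rw [StarWord.adj_mul, map_mul, map_mul, hx, hy, star_mul]

/-- The universal property of the free *-algebra. -/
def lift (T : X → B) : FreeStarAlg X →⋆ₙₐ[ℂ] B :=
  let L : FreeStarAlg X →ₙₐ[ℂ] B := MonoidAlgebra.liftMagma ℂ (evalWord T)
  have hL : ∀ w c, L (mono w c) = c • evalWord T w := fun w c => by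
    change MonoidAlgebra.liftMagma ℂ (evalWord T) (MonoidAlgebra.single w c) = _
    simp [MonoidAlgebra.liftMagma_apply_apply]
  { L with
    map_star' := fun x => by
      change L (star x) = star (L x)
      induction x using ind with
      | zero => simp
      | add x y hx hy => rw [star_add, map_add, map_add, hx, hy, star_add]
      | mono w c => rw [star_mono, hL, hL, evalWord_adj, star_smul] }

theorem lift_mono (T : X → B) (w : StarWord X) (c : ℂ) :
    lift T (mono w c) = c • evalWord T w := by
  change MonoidAlgebra.liftMagma ℂ (evalWord T) (MonoidAlgebra.single w c) = _
  simp [MonoidAlgebra.liftMagma_apply_apply]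

@[simp] theorem lift_gen (T : X → B) (x : X) : lift T (gen x) = T x := by
  rw [gen, lift_mono, one_smul]; simp [evalWord]

theorem hom_ext {f g : FreeStarAlg X →⋆ₙₐ[ℂ] B} (h : ∀ x, f (gen x) = g (gen x)) : f = g := by
  have hw : ∀ w : StarWord X, f (mono w 1) = g (mono w 1) := fun w => by
    induction w using FreeSemigroup.recOnMul with
    | ih1 x =>
      rcases x with x | x
      · exact h x
      · rw [← star_gen, map_star, map_star, h x]
    | ih2 x y hx hy =>
      have : mono (FreeSemigroup.of x * y) 1 = mono (FreeSemigroup.of x) 1 * mono y (1 : ℂ) := by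
        rw [mono_mul_mono, one_mul]
      rw [this, map_mul, map_mul, hx, hy]
  refine DFunLike.ext _ _ fun x => ?_
  induction x using ind with
  | zero => rw [map_zero, map_zero]
  | add x y hx hy => rw [map_add, map_add, hx, hy]
  | mono w c =>
    have : mono w c = c • mono w 1 := by rw [smul_mono, mul_one]
    rw [this, map_smul, map_smul, hw]

end FreeStarAlg

/-- The set of all morphisms of a category; a small category is identified with this set. The
source and target of `f : Mor C` are `f.left` and `f.right`. -/
abbrev Mor (C : Type u₁) [Category.{v₁} C] : Type (max u₁ v₁) := Quiver.Total C

namespace Mor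

section

variable {C : Type u₁} [Category.{v₁} C]

/-- The unit at an object. -/
@[reducible] def unit (x : C) : Mor C := ⟨x, x, 𝟙 x⟩

/-- The product `f g` of composable morphisms, meaning that the source of `f` is the target of
`g`. -/
@[reducible] def comp (f g : Mor C) (h : f.left = g.right) : Mor C :=
  ⟨g.left, f.right, g.hom ≫ eqToHom h.symm ≫ f.hom⟩

@[simp] theorem unit_left (x : C) : (unit x).left = x := rfl
@[simp] theorem unit_right (x : C) : (unit x).right = x := rfl
@[simp] theorem comp_left (f g : Mor C) (h : f.left = g.right) : (comp f g h).left = g.left := rfl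
@[simp] theorem comp_right (f g : Mor C) (h : f.left = g.right) :
    (comp f g h).right = f.right := rfl

theorem comp_unit (f : Mor C) {x : C} (h : f.left = x) : comp f (unit x) h = f := by
  subst h; simp [comp, unit]

theorem unit_comp (f : Mor C) {x : C} (h : x = f.right) : comp (unit x) f h = f := by
  subst h; simp [comp, unit]

theorem comp_assoc (f g k : Mor C) (h : f.left = g.right) (h' : g.left = k.right) :
    comp (comp f g h) k h' = comp f (comp g k h') h := by
  simp [comp]

theorem unit_injective {x y : C} (h : unit x = unit y) : x = y := congrArg Quiver.Total.left h

/-- `g` is a multiple of `f`. -/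
def Divides (f g : Mor C) : Prop := ∃ (k : Mor C) (h : f.left = k.right), comp f k h = g

/-- `f` and `g` have no common multiple. -/
def Disj (f g : Mor C) : Prop := ¬ ∃ m, Divides f m ∧ Divides g m

end

section

variable {G : Type u₁} [Groupoid.{v₁} G]

/-- The inverse of a morphism of a groupoid. -/
@[reducible] def inv (g : Mor G) : Mor G := ⟨g.right, g.left, Groupoid.inv g.hom⟩

@[simp] theorem inv_left (g : Mor G) : (inv g).left = g.right := rfl
@[simp] theorem inv_right (g : Mor G) : (inv g).right = g.left := rfl

@[simp] theorem inv_inv (g : Mor G) : inv (inv g) = g := by simp [inv]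

theorem comp_inv (g : Mor G) (h : g.left = (inv g).right) : comp g (inv g) h = unit g.right := by
  simp [comp, inv, unit]

theorem inv_comp (g : Mor G) (h : (inv g).left = g.right) : comp (inv g) g h = unit g.left := by
  simp [comp, inv, unit]

theorem inv_comp_rev (f g : Mor G) (h : f.left = g.right) :
    inv (comp f g h) = comp (inv g) (inv f) h.symm := by
  obtain ⟨a, b, f⟩ := f
  obtain ⟨c, d, g⟩ := g
  obtain rfl : a = d := h
  simp [comp, inv]

end

end Mor

section CategoryCStar

variable {C : Type u₁} [Category.{v₁} C]

/-- A representation of a small category in a C*-algebra. -/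
structure IsCatRep {B : Type*} [NonUnitalCStarAlgebra B] (T : Mor C → B) : Prop where
  partialIsometry : ∀ f, T f * star (T f) * T f = T f
  mul_of_comp : ∀ f g (h : f.left = g.right), T f * T g = T (Mor.comp f g h)
  mul_of_not_comp : ∀ f g : Mor C, f.left ≠ g.right → T f * T g = 0
  commute_initial : ∀ f g, Commute (star (T f) * T f) (star (T g) * T g)
  commute_final : ∀ f g, Commute (T f * star (T f)) (T g * star (T g))
  commute_initial_final : ∀ f g, Commute (star (T f) * T f) (T g * star (T g))
  disjoint : ∀ f g, Mor.Disj f g → (T f * star (T f)) * (T g * star (T g)) = 0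
  initial_mul_final : ∀ f g : Mor C, f.left = g.right →
    (star (T f) * T f) * (T g * star (T g)) = T g * star (T g)

theorem norm_le_one_of_partialIsometry {B : Type*} [NonUnitalCStarAlgebra B] {S : B}
    (h : S * star S * S = S) : ‖S‖ ≤ 1 := by
  have h1 : ‖star S * S‖ = ‖S‖ * ‖S‖ := CStarRing.norm_star_mul_self
  have h2 : ‖star (star S * S) * (star S * S)‖ = ‖star S * S‖ * ‖star S * S‖ :=
    CStarRing.norm_star_mul_self
  have h3 : star (star S * S) * (star S * S) = star S * S := by
    rw [star_mul, star_star, mul_assoc, ← mul_assoc S, h]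
  rw [h3, h1] at h2
  by_contra hc
  push Not at hc
  have h0 : 1 < ‖S‖ * ‖S‖ := by nlinarith
  generalize ‖S‖ * ‖S‖ = m at h0 h2
  nlinarith

variable (C) in
/-- The C*-seminorms on the free *-algebra on the morphisms of `C` for which the generators become
a representation of `C`. -/
def catSeminorms : Set (CStarSeminorm (FreeStarAlg (Mor C))) :=
  {p | IsCatRep fun f : Mor C => p.incl (FreeStarAlg.gen f)}

theorem catSeminorms_bounded (x : FreeStarAlg (Mor C)) : ∃ M : ℝ, ∀ p ∈ catSeminorms C, p x ≤ M := by
  have hg : ∀ p ∈ catSeminorms C, ∀ f : Mor C, p (FreeStarAlg.gen f) ≤ 1 := fun p hp f => by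
    rw [← p.norm_incl]
    exact norm_le_one_of_partialIsometry (hp.partialIsometry f)
  have hw : ∀ p ∈ catSeminorms C, ∀ w, p (FreeStarAlg.mono w 1) ≤ 1 := fun p hp w => by
    induction w using FreeSemigroup.recOnMul with
    | ih1 f =>
      rcases f with f | f
      · exact hg p hp f
      · rw [← FreeStarAlg.star_gen, p.apply_star]; exact hg p hp f
    | ih2 f y hf hy =>
      have : FreeStarAlg.mono (FreeSemigroup.of f * y) 1 =
          FreeStarAlg.mono (FreeSemigroup.of f) 1 * FreeStarAlg.mono y (1 : ℂ) := by
        rw [FreeStarAlg.mono_mul_mono, one_mul]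
      rw [this]
      refine (p.mul_le' _ _).trans ?_
      exact mul_le_one₀ hf (p.nonneg _) hy
  induction x using FreeStarAlg.ind with
  | zero => exact ⟨0, fun p _ => p.map_zero.le⟩
  | add x y hx hy =>
    obtain ⟨M, hM⟩ := hx
    obtain ⟨N, hN⟩ := hy
    exact ⟨M + N, fun p hp => (p.add_le x y).trans (add_le_add (hM p hp) (hN p hp))⟩
  | mono w c =>
    refine ⟨‖c‖, fun p hp => ?_⟩
    have : FreeStarAlg.mono w c = c • FreeStarAlg.mono w 1 := by
      rw [FreeStarAlg.smul_mono, mul_one]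
    rw [this, p.map_smul]
    exact mul_le_of_le_one_right (norm_nonneg c) (hw p hp w)

variable (C) in
/-- The largest C*-seminorm for which the generators become a representation of `C`. -/
def catSeminorm : CStarSeminorm (FreeStarAlg (Mor C)) :=
  CStarSeminorm.sup (catSeminorms C) catSeminorms_bounded

variable (C) in
/-- The semigroupoid C*-algebra `C*(C)` of a small category `C`: the universal C*-algebra generated
by a representation of `C`. -/
abbrev CatCStar : Type (max u₁ v₁) := (catSeminorm C).Compl

namespace CatCStar

/-- The canonical generators `S_f` of `C*(C)`. -/
def S (f : Mor C) : CatCStar C := (catSeminorm C).incl (FreeStarAlg.gen f)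

theorem incl_catSeminorm_eq {x y : FreeStarAlg (Mor C)}
    (h : ∀ p : CStarSeminorm (FreeStarAlg (Mor C)),
      (IsCatRep fun f : Mor C => p.incl (FreeStarAlg.gen f)) → p.incl x = p.incl y) :
    (catSeminorm C).incl x = (catSeminorm C).incl y :=
  CStarSeminorm.incl_sup_eq catSeminorms_bounded h

/-- The generators form a representation. -/
theorem isCatRep_S : IsCatRep (S : Mor C → CatCStar C) := by
  change IsCatRep fun f => (catSeminorm C).incl (FreeStarAlg.gen f)
  constructor
  all_goals first | intro f g h | intro f g | intro f
  all_goals try rw [← CStarSeminorm.incl_zero]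
  all_goals try rw [commute_iff_eq]
  all_goals simp only [← CStarSeminorm.incl_mul, ← CStarSeminorm.incl_star]
  all_goals refine incl_catSeminorm_eq fun p hp => ?_
  all_goals simp only [CStarSeminorm.incl_mul, CStarSeminorm.incl_star, CStarSeminorm.incl_zero]
  · exact hp.partialIsometry f
  · exact hp.mul_of_comp f g h
  · exact hp.mul_of_not_comp f g h
  · exact hp.commute_initial f g
  · exact hp.commute_final f g
  · exact hp.commute_initial_final f g
  · exact hp.disjoint f g h
  · exact hp.initial_mul_final f g h

variable {B : Type*} [NonUnitalCStarAlgebra B]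

theorem ofHom_mem_catSeminorms {T : Mor C → B} (hT : IsCatRep T) :
    CStarSeminorm.ofHom (FreeStarAlg.lift T) ∈ catSeminorms C := by
  constructor
  all_goals first | intro f g h | intro f g | intro f
  all_goals try rw [← CStarSeminorm.incl_zero]
  all_goals try rw [commute_iff_eq]
  all_goals simp only [← CStarSeminorm.incl_mul, ← CStarSeminorm.incl_star]
  all_goals refine CStarSeminorm.incl_ofHom_eq _ ?_
  all_goals simp only [map_mul, map_star, FreeStarAlg.lift_gen, map_zero]
  · exact hT.partialIsometry f
  · exact hT.mul_of_comp f g h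
  · exact hT.mul_of_not_comp f g h
  · exact hT.commute_initial f g
  · exact hT.commute_final f g
  · exact hT.commute_initial_final f g
  · exact hT.disjoint f g h
  · exact hT.initial_mul_final f g h

/-- The universal property of `C*(C)`: a representation `T` of `C` in a C*-algebra induces a
*-homomorphism with `S_f ↦ T_f`. -/
def lift (T : Mor C → B) (hT : IsCatRep T) : CatCStar C →⋆ₙₐ[ℂ] B :=
  CStarSeminorm.lift (FreeStarAlg.lift T)
    fun x => CStarSeminorm.le_sup catSeminorms_bounded (ofHom_mem_catSeminorms hT) x

@[simp] theorem lift_S (T : Mor C → B) (hT : IsCatRep T) (f : Mor C) : lift T hT (S f) = T f :=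
  (CStarSeminorm.lift_incl _ _ _).trans (FreeStarAlg.lift_gen T f)

/-- A *-homomorphism on `C*(C)` is determined by its values on the generators. -/
theorem hom_ext {f g : CatCStar C →⋆ₙₐ[ℂ] B} (h : ∀ m, f (S m) = g (S m)) : f = g := by
  refine CStarSeminorm.compl_hom_ext fun x => ?_
  have : NonUnitalStarAlgHom.comp f (catSeminorm C).inclHom =
      NonUnitalStarAlgHom.comp g (catSeminorm C).inclHom := FreeStarAlg.hom_ext h
  exact DFunLike.congr_fun this x

/-- An induction principle: `C*(C)` is the closed *-subalgebra generated by the `S_f`. -/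
theorem mem_of_closed (K : NonUnitalStarSubalgebra ℂ (CatCStar C))
    (hK : IsClosed (K : Set (CatCStar C))) (h : ∀ f, S f ∈ K) (x : CatCStar C) : x ∈ K := by
  refine (catSeminorm C).compl_induction₁ (P := fun x => x ∈ K) hK (fun x => ?_) x
  have hw : ∀ w, (catSeminorm C).incl (FreeStarAlg.mono w 1) ∈ K := fun w => by
    induction w using FreeSemigroup.recOnMul with
    | ih1 f =>
      rcases f with f | f
      · exact h f
      · rw [← FreeStarAlg.star_gen, CStarSeminorm.incl_star]; exact star_mem (h f)
    | ih2 f y hf hy =>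
      have : FreeStarAlg.mono (FreeSemigroup.of f * y) 1 =
          FreeStarAlg.mono (FreeSemigroup.of f) 1 * FreeStarAlg.mono y (1 : ℂ) := by
        rw [FreeStarAlg.mono_mul_mono, one_mul]
      rw [this, CStarSeminorm.incl_mul]
      exact mul_mem hf hy
  induction x using FreeStarAlg.ind with
  | zero => rw [CStarSeminorm.incl_zero]; exact zero_mem K
  | add x y hx hy => rw [CStarSeminorm.incl_add]; exact add_mem hx hy
  | mono w c =>
    have : FreeStarAlg.mono w c = c • FreeStarAlg.mono w 1 := by
      rw [FreeStarAlg.smul_mono, mul_one]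
    rw [this, CStarSeminorm.incl_smul]
    exact SMulMemClass.smul_mem c (hw w)

end CatCStar

end CategoryCStar

/-- A quasi action of a (discrete) groupoid `G` on a C*-algebra `A`. -/
structure QuasiAction (G : Type u₁) [Groupoid.{v₁} G] (A : Type w) [NonUnitalCStarAlgebra A] where
  /-- The *-homomorphism `β_g : A → A`. -/
  hom : Mor G → A →⋆ₙₐ[ℂ] A
  /-- The closed *-subalgebra `D(β_g)` of `A`. -/
  dom : Mor G → NonUnitalStarSubalgebra ℂ A
  isClosed_dom : ∀ g, IsClosed (dom g : Set A)
  /-- `β_g` restricts to an isomorphism from `D(β_g)` onto `β_g(A)`. -/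
  bijOn_dom : ∀ g, Set.BijOn (hom g) (dom g) (Set.range (hom g))
  range_eq_dom : ∀ s t : Mor G, s.left = t.right → Set.range (hom t) = dom s
  dom_comp : ∀ (s t : Mor G) (h : s.left = t.right), dom (Mor.comp s t h) = dom t
  hom_comp : ∀ (s t : Mor G) (h : s.left = t.right) (a : A),
    hom (Mor.comp s t h) a = hom s (hom t a)
  hom_not_comp : ∀ s t : Mor G, s.left ≠ t.right → ∀ a : A, hom s (hom t a) = 0

namespace QuasiAction

variable {G : Type u₁} [Groupoid.{v₁} G] {A : Type w} [NonUnitalCStarAlgebra A]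
  (β : QuasiAction G A)

theorem hom_mem_dom_inv (t : Mor G) (a : A) : β.hom t a ∈ β.dom t.inv := by
  have := β.range_eq_dom t.inv t rfl
  exact (Set.ext_iff.1 this _).1 ⟨a, rfl⟩

theorem dom_inv_comp (t u : Mor G) (h : t.left = u.right) :
    β.dom (Mor.comp t u h).inv = β.dom t.inv := by
  rw [Mor.inv_comp_rev]; exact β.dom_comp _ _ _

theorem hom_unit (x : G) {a : A} (ha : a ∈ β.dom (Mor.unit x)) : β.hom (Mor.unit x) a = a := by
  have h1 : β.hom (Mor.unit x) a ∈ β.dom (Mor.unit x) := by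
    have := β.range_eq_dom (Mor.unit x) (Mor.unit x) rfl
    exact (Set.ext_iff.1 this _).1 ⟨a, rfl⟩
  refine (β.bijOn_dom (Mor.unit x)).injOn h1 ha ?_
  have := β.hom_comp (Mor.unit x) (Mor.unit x) rfl a
  rw [Mor.comp_unit] at this
  exact this.symm

theorem dom_unit (t : Mor G) : β.dom (Mor.unit t.right) = β.dom t.inv := by
  rw [← Mor.comp_inv t rfl]; exact β.dom_comp _ _ _

theorem hom_hom_inv (t : Mor G) {a : A} (ha : a ∈ β.dom t.inv) :
    β.hom t (β.hom t.inv a) = a := by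
  rw [← β.hom_comp t t.inv rfl, Mor.comp_inv]
  exact β.hom_unit _ (by rw [dom_unit]; exact ha)

/-- Finitely supported functions `∑ a_t t` on `G` with values in `A`. -/
def Conv (_β : QuasiAction G A) : Type _ := Mor G →₀ A

namespace Conv

variable {β}

instance : AddCommGroup β.Conv := inferInstanceAs (AddCommGroup (Mor G →₀ A))
instance : Module ℂ β.Conv := inferInstanceAs (Module ℂ (Mor G →₀ A))

variable (β) in
/-- The element `a t`. -/
def mono (t : Mor G) (a : A) : β.Conv := Finsupp.single t a

theorem mono_zero (t : Mor G) : mono β t 0 = 0 := Finsupp.single_zero t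

theorem mono_add (t : Mor G) (a b : A) : mono β t (a + b) = mono β t a + mono β t b :=
  Finsupp.single_add t a b

theorem smul_mono (c : ℂ) (t : Mor G) (a : A) : c • mono β t a = mono β t (c • a) :=
  Finsupp.smul_single c t a

@[elab_as_elim]
theorem ind {P : β.Conv → Prop} (f : β.Conv) (zero : P 0)
    (add : ∀ f g, P f → P g → P (f + g)) (mono : ∀ t a, P (mono β t a)) : P f :=
  Finsupp.induction_linear f zero add mono

open Classical in
variable (β) in
/-- The product `(a t)(b u)`, which is `a β_t(b) (tu)` if `t` and `u` are composable and `0`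
otherwise. -/
def monoMul (t : Mor G) (a : A) (u : Mor G) (b : A) : β.Conv :=
  if h : t.left = u.right then mono β (Mor.comp t u h) (a * β.hom t b) else 0

theorem monoMul_of_comp {t u : Mor G} (h : t.left = u.right) (a b : A) :
    monoMul β t a u b = mono β (Mor.comp t u h) (a * β.hom t b) := dif_pos h

theorem monoMul_of_not {t u : Mor G} (h : t.left ≠ u.right) (a b : A) :
    monoMul β t a u b = 0 := dif_neg h

theorem monoMul_add_left (t : Mor G) (a a' : A) (u : Mor G) (b : A) :
    monoMul β t (a + a') u b = monoMul β t a u b + monoMul β t a' u b := by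
  by_cases h : t.left = u.right
  · simp only [monoMul_of_comp h, add_mul, mono_add]
  · simp only [monoMul_of_not h, add_zero]

theorem monoMul_add_right (t : Mor G) (a : A) (u : Mor G) (b b' : A) :
    monoMul β t a u (b + b') = monoMul β t a u b + monoMul β t a u b' := by
  by_cases h : t.left = u.right
  · simp only [monoMul_of_comp h, map_add, mul_add, mono_add]
  · simp only [monoMul_of_not h, add_zero]

theorem monoMul_zero_left (t u : Mor G) (b : A) : monoMul β t 0 u b = 0 := by
  by_cases h : t.left = u.right
  · simp only [monoMul_of_comp h, zero_mul, mono_zero]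
  · exact monoMul_of_not h _ _

theorem monoMul_zero_right (t : Mor G) (a : A) (u : Mor G) : monoMul β t a u 0 = 0 := by
  by_cases h : t.left = u.right
  · simp only [monoMul_of_comp h, map_zero, mul_zero, mono_zero]
  · exact monoMul_of_not h _ _

instance : Mul β.Conv :=
  ⟨fun f g => Finsupp.sum (show Mor G →₀ A from f) fun t a =>
    Finsupp.sum (show Mor G →₀ A from g) fun u b => monoMul β t a u b⟩

theorem add_mul' (f f' g : β.Conv) : (f + f') * g = f * g + f' * g := by
  refine Finsupp.sum_add_index' (f := (show Mor G →₀ A from f)) (g := (show Mor G →₀ A from f'))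
    (fun t => ?_) (fun t a a' => ?_)
  · simp only [monoMul_zero_left]; exact Finsupp.sum_fun_zero _
  · simp only [monoMul_add_left]; exact Finsupp.sum_add

theorem mul_add' (f g g' : β.Conv) : f * (g + g') = f * g + f * g' := by
  have : ∀ t a, (Finsupp.sum (show Mor G →₀ A from g + g') fun u b => monoMul β t a u b) =
      (Finsupp.sum (show Mor G →₀ A from g) fun u b => monoMul β t a u b) +
      (Finsupp.sum (show Mor G →₀ A from g') fun u b => monoMul β t a u b) := fun t a =>
    Finsupp.sum_add_index' (fun u => monoMul_zero_right t a u) fun u b b' =>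
      monoMul_add_right t a u b b'
  change (Finsupp.sum (show Mor G →₀ A from f) fun t a =>
    Finsupp.sum (show Mor G →₀ A from g + g') fun u b => monoMul β t a u b) = _
  simp only [this]
  exact Finsupp.sum_add

theorem zero_mul' (g : β.Conv) : 0 * g = 0 := Finsupp.sum_zero_index

theorem mul_zero' (f : β.Conv) : f * 0 = 0 := by
  change (Finsupp.sum (show Mor G →₀ A from f) fun t a =>
    Finsupp.sum (0 : Mor G →₀ A) fun u b => monoMul β t a u b) = _
  simp only [Finsupp.sum_zero_index]
  exact Finsupp.sum_fun_zero _

theorem mono_mul_mono (t : Mor G) (a : A) (u : Mor G) (b : A) :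
    mono β t a * mono β u b = monoMul β t a u b := by
  change (Finsupp.sum (Finsupp.single t a) fun t a =>
    Finsupp.sum (Finsupp.single u b) fun u b => monoMul β t a u b) = _
  rw [Finsupp.sum_single_index, Finsupp.sum_single_index]
  · exact monoMul_zero_right t a u
  · rw [Finsupp.sum_single_index]
    · exact monoMul_zero_left t u b
    · exact monoMul_zero_right t 0 u

theorem mul_assoc' (f g k : β.Conv) : f * g * k = f * (g * k) := by
  induction f using ind with
  | zero => rw [zero_mul', zero_mul', zero_mul']
  | add f f' hf hf' => rw [add_mul', add_mul', add_mul', hf, hf']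
  | mono t a =>
    induction g using ind with
    | zero => rw [mul_zero', zero_mul', mul_zero']
    | add g g' hg hg' => rw [mul_add', add_mul', add_mul', mul_add', hg, hg']
    | mono u b =>
      induction k using ind with
      | zero => rw [mul_zero', mul_zero', mul_zero']
      | add k k' hk hk' => rw [mul_add', mul_add', mul_add', hk, hk']
      | mono v c =>
        rw [mono_mul_mono, mono_mul_mono]
        by_cases h : t.left = u.right
        · rw [monoMul_of_comp h, mono_mul_mono]
          by_cases h' : u.left = v.right
          · rw [monoMul_of_comp h', mono_mul_mono, monoMul_of_comp (by exact h'),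
              monoMul_of_comp (by exact h), map_mul, β.hom_comp, mul_assoc, Mor.comp_assoc]
          · rw [monoMul_of_not h', mul_zero', monoMul_of_not (by exact h')]
        · rw [monoMul_of_not h, zero_mul']
          by_cases h' : u.left = v.right
          · rw [monoMul_of_comp h', mono_mul_mono, monoMul_of_not (by exact h)]
          · rw [monoMul_of_not h', mul_zero']

instance : NonUnitalRing β.Conv where
  left_distrib := mul_add'
  right_distrib := add_mul'
  zero_mul := zero_mul'
  mul_zero := mul_zero'
  mul_assoc := mul_assoc'

instance : IsScalarTower ℂ β.Conv β.Conv where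
  smul_assoc c f g := by
    change (c • f) * g = c • (f * g)
    induction f using ind with
    | zero => simp
    | add f f' hf hf' => rw [smul_add, add_mul, add_mul, hf, hf', smul_add]
    | mono t a =>
      induction g using ind with
      | zero => simp
      | add g g' hg hg' => rw [mul_add, mul_add, hg, hg', smul_add]
      | mono u b =>
        rw [smul_mono, mono_mul_mono, mono_mul_mono]
        by_cases h : t.left = u.right
        · rw [monoMul_of_comp h, monoMul_of_comp h, smul_mono, smul_mul_assoc]
        · rw [monoMul_of_not h, monoMul_of_not h, smul_zero]

instance : SMulCommClass ℂ β.Conv β.Conv where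
  smul_comm c f g := by
    change c • (f * g) = f * (c • g)
    induction f using ind with
    | zero => simp
    | add f f' hf hf' => rw [add_mul, add_mul, ← hf, ← hf', smul_add]
    | mono t a =>
      induction g using ind with
      | zero => simp
      | add g g' hg hg' => rw [smul_add, mul_add, mul_add, ← hg, ← hg', smul_add]
      | mono u b =>
        rw [smul_mono, mono_mul_mono, mono_mul_mono]
        by_cases h : t.left = u.right
        · rw [monoMul_of_comp h, monoMul_of_comp h, smul_mono, map_smul, mul_smul_comm]
        · rw [monoMul_of_not h, monoMul_of_not h, smul_zero]

/-- The map `∑ a_t t ↦ ∑ β_{t⁻¹}(a_t*) t⁻¹`, that is `f*(t) = β_t(f(t⁻¹)*)`. -/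
def adj : β.Conv →+ β.Conv :=
  Finsupp.liftAddHom (M := A) (N := β.Conv) fun t : Mor G =>
    { toFun := fun a => mono β t.inv (β.hom t.inv (star a))
      map_zero' := by rw [star_zero, map_zero, mono_zero]
      map_add' := fun a b => by rw [star_add, map_add, mono_add] }

theorem adj_mono (t : Mor G) (a : A) :
    adj (mono β t a) = mono β t.inv (β.hom t.inv (star a)) :=
  Finsupp.liftAddHom_apply_single _ _ _

theorem adj_mul (f g : β.Conv) : adj (f * g) = adj g * adj f := by
  induction f using ind with
  | zero => simp
  | add f f' hf hf' => rw [add_mul, map_add, map_add, hf, hf', mul_add]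
  | mono t a =>
    induction g using ind with
    | zero => simp
    | add g g' hg hg' => rw [mul_add, map_add, map_add, hg, hg', add_mul]
    | mono u b =>
      rw [mono_mul_mono, adj_mono, adj_mono, mono_mul_mono]
      by_cases h : t.left = u.right
      · rw [monoMul_of_comp h, monoMul_of_comp (by exact h.symm), adj_mono, Mor.inv_comp_rev,
          β.hom_comp, star_mul, map_mul, map_mul, ← map_star (β.hom t), ← β.hom_comp t.inv t rfl,
          Mor.inv_comp, ← β.hom_comp u.inv (Mor.unit t.left) (by exact h.symm), Mor.comp_unit]
      · rw [monoMul_of_not h, monoMul_of_not (by exact fun e => h e.symm), map_zero]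

theorem adj_smul (c : ℂ) (f : β.Conv) : adj (c • f) = star c • adj f := by
  induction f using ind with
  | zero => simp
  | add f f' hf hf' => rw [smul_add, map_add, map_add, hf, hf', smul_add]
  | mono t a => rw [smul_mono, adj_mono, adj_mono, smul_mono, star_smul, map_smul]

end Conv

/-- The coefficient `a_t` of `f = ∑ a_t t`. -/
def Conv.coeff {β : QuasiAction G A} (f : β.Conv) (t : Mor G) : A :=
  DFunLike.coe (show Mor G →₀ A from f) t

theorem Conv.sum_mono {β : QuasiAction G A} (f : β.Conv) :
    (Finsupp.sum (show Mor G →₀ A from f) fun t a => mono β t a) = f :=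
  Finsupp.sum_single (show Mor G →₀ A from f)

/-- The subspace of finite sums `∑ a_t t` with `a_t ∈ D(β_{t⁻¹})`. -/
def algSubmodule : Submodule ℂ β.Conv where
  carrier := {f | ∀ t, f.coeff t ∈ β.dom t.inv}
  zero_mem' t := zero_mem (β.dom t.inv)
  add_mem' hf hg t := add_mem (s := β.dom t.inv) (hf t) (hg t)
  smul_mem' c _ hf t := SMulMemClass.smul_mem (s := β.dom t.inv) c (hf t)

theorem mono_mem_algSubmodule {t : Mor G} {a : A} (ha : a ∈ β.dom t.inv) :
    Conv.mono β t a ∈ β.algSubmodule := by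
  intro u
  change (Finsupp.single t a) u ∈ _
  by_cases h : t = u
  · subst h; rwa [Finsupp.single_eq_same]
  · rw [Finsupp.single_eq_of_ne (Ne.symm h)]; exact zero_mem _

theorem algSubmodule_induction {P : β.Conv → Prop} (zero : P 0)
    (add : ∀ f g, P f → P g → P (f + g))
    (mono : ∀ t a, a ∈ β.dom t.inv → P (Conv.mono β t a)) {f : β.Conv}
    (hf : f ∈ β.algSubmodule) : P f := by
  rw [← f.sum_mono]
  exact Finset.sum_induction _ P add zero fun t _ => mono t _ (hf t)

theorem mul_mem_algSubmodule {f g : β.Conv} (hf : f ∈ β.algSubmodule)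
    (hg : g ∈ β.algSubmodule) : f * g ∈ β.algSubmodule := by
  refine β.algSubmodule_induction (P := fun f => f * g ∈ β.algSubmodule) ?_ ?_ ?_ hf
  · rw [zero_mul]; exact zero_mem _
  · intro f f' hf hf'; rw [add_mul]; exact add_mem hf hf'
  · intro t a ha
    refine β.algSubmodule_induction (P := fun g => Conv.mono β t a * g ∈ β.algSubmodule)
      ?_ ?_ ?_ hg
    · rw [mul_zero]; exact zero_mem _
    · intro g g' hg hg'; rw [mul_add]; exact add_mem hg hg'
    · intro u b _
      rw [Conv.mono_mul_mono]
      by_cases h : t.left = u.right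
      · rw [Conv.monoMul_of_comp h]
        refine β.mono_mem_algSubmodule ?_
        rw [dom_inv_comp]
        exact mul_mem ha (β.hom_mem_dom_inv t b)
      · rw [Conv.monoMul_of_not h]; exact zero_mem _

theorem adj_mem_algSubmodule {f : β.Conv} (hf : f ∈ β.algSubmodule) :
    Conv.adj f ∈ β.algSubmodule := by
  refine β.algSubmodule_induction (P := fun f => Conv.adj f ∈ β.algSubmodule) ?_ ?_ ?_ hf
  · rw [map_zero]; exact zero_mem _
  · intro f g hf hg; rw [map_add]; exact add_mem hf hg
  · intro t a _
    rw [Conv.adj_mono]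
    exact β.mono_mem_algSubmodule (β.hom_mem_dom_inv t.inv _)

theorem adj_adj {f : β.Conv} (hf : f ∈ β.algSubmodule) : Conv.adj (Conv.adj f) = f := by
  refine β.algSubmodule_induction (P := fun f => Conv.adj (Conv.adj f) = f) ?_ ?_ ?_ hf
  · rw [map_zero, map_zero]
  · intro f g hf hg; rw [map_add, map_add, hf, hg]
  · intro t a ha
    rw [Conv.adj_mono, Conv.adj_mono, ← map_star, star_star, Mor.inv_inv, β.hom_hom_inv t ha]

/-- The algebra `A[G]` of finite sums `∑ a_t t` with `a_t ∈ D(β_{t⁻¹})`. -/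
def algSubalgebra : NonUnitalSubalgebra ℂ β.Conv where
  __ := β.algSubmodule
  mul_mem' := β.mul_mem_algSubmodule

/-- The *-algebra `A[G]` of finite sums `∑ a_t t` with `a_t ∈ D(β_{t⁻¹})`. -/
abbrev Alg : Type (max u₁ v₁ w) := β.algSubalgebra

namespace Alg

variable {β}

instance : Star β.Alg := ⟨fun f => ⟨Conv.adj f.1, β.adj_mem_algSubmodule f.2⟩⟩

theorem coe_star (f : β.Alg) : (↑(star f) : β.Conv) = Conv.adj f.1 := rfl

instance : StarRing β.Alg where
  star_involutive f := Subtype.ext (β.adj_adj f.2)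
  star_mul f g := Subtype.ext (Conv.adj_mul f.1 g.1)
  star_add f g := Subtype.ext (map_add Conv.adj f.1 g.1)

instance : StarModule ℂ β.Alg where
  star_smul c f := Subtype.ext (Conv.adj_smul c f.1)

/-- The element `a t` of `A[G]`, for `a ∈ D(β_{t⁻¹})`. -/
def mono (t : Mor G) (a : A) (ha : a ∈ β.dom t.inv) : β.Alg :=
  ⟨Conv.mono β t a, β.mono_mem_algSubmodule ha⟩

/-- The norm `‖∑ a_t t‖₁ = ∑ ‖a_t‖`. -/
def l1norm (f : β.Alg) : ℝ := Finsupp.sum (show Mor G →₀ A from f.1) fun _ a => ‖a‖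

end Alg

/-- The C*-seminorms `f ↦ ‖σ f‖`, where `σ` runs over all `ℓ¹`-contractive *-representations of
`A[G]` on Hilbert spaces. -/
def repSeminorms : Set (CStarSeminorm β.Alg) :=
  {p | ∃ (K : Type (max u₁ v₁ w)) (_ : NormedAddCommGroup K) (_ : InnerProductSpace ℂ K)
    (_ : CompleteSpace K) (σ : β.Alg →⋆ₙₐ[ℂ] (K →L[ℂ] K)),
    (∀ f, ‖σ f‖ ≤ f.l1norm) ∧ p = CStarSeminorm.ofHom σ}

theorem repSeminorms_bounded (f : β.Alg) : ∃ M : ℝ, ∀ p ∈ β.repSeminorms, p f ≤ M :=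
  ⟨f.l1norm, by rintro _ ⟨K, _, _, _, σ, hσ, rfl⟩; exact hσ f⟩

/-- The norm `‖f‖ = sup_σ ‖σ f‖` on `A[G]`. -/
def crossedNorm : CStarSeminorm β.Alg :=
  CStarSeminorm.sup β.repSeminorms β.repSeminorms_bounded

/-- The crossed product of `A` by the quasi action `β` of `G`, the enveloping C*-algebra
of `A[G]`. -/
abbrev CrossedProduct : Type (max u₁ v₁ w) := β.crossedNorm.Compl

/-- The canonical map from `A[G]` to the crossed product. -/
def toCrossed : β.Alg →⋆ₙₐ[ℂ] β.CrossedProduct := β.crossedNorm.inclHom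

end QuasiAction

/-- A left action of a small category `G` on a small category `H` with respect to a surjective map
`φ` from the units of `H` to the units of `G`. -/
structure CatAction (G : Type u₁) [Category.{v₁} G] (H : Type u₂) [Category.{v₂} H] where
  /-- The map on units. -/
  φ : H → G
  φ_surjective : Function.Surjective φ
  /-- The morphism `α_g(h)`, defined if `s(g) = φ(t(h)) = φ(s(h))`. -/
  act : (g : Mor G) → (h : Mor H) → (g.left = φ h.right ∧ φ h.right = φ h.left) → Mor H
  act_left : ∀ g h hd hd', act g (Mor.unit h.left) hd' = Mor.unit (act g h hd).left
  act_right : ∀ g h hd hd', act g (Mor.unit h.right) hd' = Mor.unit (act g h hd).right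
  φ_act_unit : ∀ g u hd, φ (act g (Mor.unit u) hd).left = g.right
  act_unit : ∀ h hd, act (Mor.unit (φ h.right)) h hd = h
  act_act : ∀ (g' g : Mor G) (hg : g'.left = g.right) h hd hd' hd'',
    act g' (act g h hd) hd' = act (Mor.comp g' g hg) h hd''
  act_comp : ∀ g (h' h : Mor H) (hh : h'.left = h.right) hd' hd hd''
    (hh' : (act g h' hd').left = (act g h hd).right),
    act g (Mor.comp h' h hh) hd'' = Mor.comp (act g h' hd') (act g h hd) hh'

namespace CatAction

section Basic

variable {G : Type u₁} [Category.{v₁} G] {H : Type u₂} [Category.{v₂} H] (α : CatAction G H)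

/-- `α.Dom g h` means that `h ∈ H^g`, that is `s(g) = φ(s(h)) = φ(t(h))`. -/
@[reducible] def Dom (g : Mor G) (h : Mor H) : Prop :=
  g.left = α.φ h.right ∧ α.φ h.right = α.φ h.left

/-- An action is regular if `φ(s(h)) = φ(t(h))` for all `h`. -/
def IsRegular : Prop := ∀ h : Mor H, α.φ h.left = α.φ h.right

variable {α}

theorem act_congr {g g' : Mor G} {h h' : Mor H} (hg : g = g') (hh : h = h') (hd : α.Dom g h)
    (hd' : α.Dom g' h') : α.act g h hd = α.act g' h' hd' := by
  subst hg hh; rfl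

theorem Dom.unit_left {g : Mor G} {h : Mor H} (hd : α.Dom g h) : α.Dom g (Mor.unit h.left) :=
  ⟨hd.1.trans hd.2, rfl⟩

theorem Dom.unit_right {g : Mor G} {h : Mor H} (hd : α.Dom g h) : α.Dom g (Mor.unit h.right) :=
  ⟨hd.1, rfl⟩

theorem φ_act_left {g : Mor G} {h : Mor H} (hd : α.Dom g h) :
    α.φ (α.act g h hd).left = g.right := by
  rw [← α.φ_act_unit g h.left hd.unit_left, α.act_left g h hd hd.unit_left]

theorem φ_act_right {g : Mor G} {h : Mor H} (hd : α.Dom g h) :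
    α.φ (α.act g h hd).right = g.right := by
  rw [← α.φ_act_unit g h.right hd.unit_right, α.act_right g h hd hd.unit_right]

theorem dom_act {g g' : Mor G} {h : Mor H} (hd : α.Dom g h) (hg : g'.left = g.right) :
    α.Dom g' (α.act g h hd) :=
  ⟨hg.trans (φ_act_right hd).symm, (φ_act_right hd).trans (φ_act_left hd).symm⟩

theorem act_unit' {x : G} {h : Mor H} (hd : α.Dom (Mor.unit x) h) :
    α.act (Mor.unit x) h hd = h := by
  obtain ⟨h1, h2⟩ := hd
  obtain rfl : x = α.φ h.right := h1
  exact α.act_unit h _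

theorem act_left_eq_right {g : Mor G} {f k : Mor H} (hf : α.Dom g f) (hk : α.Dom g k)
    (h : f.left = k.right) : (α.act g f hf).left = (α.act g k hk).right := by
  apply Mor.unit_injective
  rw [← α.act_left g f hf hf.unit_left, ← α.act_right g k hk hk.unit_right]
  exact act_congr rfl (by rw [h]) _ _

end Basic

section Groupoid

variable {G : Type u₁} [Groupoid.{v₁} G] {H : Type u₂} [Category.{v₂} H] {α : CatAction G H}

theorem act_inv_act {g : Mor G} {h : Mor H} (hd : α.Dom g h) (hd' : α.Dom g.inv (α.act g h hd)) :
    α.act g.inv (α.act g h hd) hd' = h := by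
  have hd'' : α.Dom (Mor.unit g.left) h := hd
  rw [α.act_act g.inv g rfl h hd hd' (by exact hd), act_congr (Mor.inv_comp g rfl) rfl _ hd'']
  exact act_unit' _

theorem act_act_inv {g : Mor G} {h : Mor H} (hd : α.Dom g.inv h) (hd' : α.Dom g (α.act g.inv h hd)) :
    α.act g (α.act g.inv h hd) hd' = h := by
  have hd'' : α.Dom (Mor.unit g.right) h := hd
  rw [α.act_act g g.inv rfl h hd hd' (by exact hd), act_congr (Mor.comp_inv g rfl) rfl _ hd'']
  exact act_unit' _

theorem left_eq_right_of_act {g : Mor G} {f k : Mor H} (hf : α.Dom g f) (hk : α.Dom g k)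
    (h : (α.act g f hf).left = (α.act g k hk).right) : f.left = k.right := by
  have := act_left_eq_right (dom_act (g' := g.inv) hf rfl) (dom_act (g' := g.inv) hk rfl) h
  rwa [act_inv_act, act_inv_act] at this

theorem disj_act (hα : α.IsRegular) {g : Mor G} {f k : Mor H} (hf : α.Dom g f) (hk : α.Dom g k)
    (h : Mor.Disj f k) : Mor.Disj (α.act g f hf) (α.act g k hk) := by
  rintro ⟨m, ⟨a, ha, hm⟩, ⟨b, hb, hm'⟩⟩
  apply h
  have hda : α.Dom g.inv a := ⟨by rw [← ha]; exact (φ_act_left hf).symm, (hα a).symm⟩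
  have hdb : α.Dom g.inv b := ⟨by rw [← hb]; exact (φ_act_left hk).symm, (hα b).symm⟩
  have hdf := dom_act (g' := g.inv) hf rfl
  have hdk := dom_act (g' := g.inv) hk rfl
  have hdm : α.Dom g.inv m := ⟨by rw [← hm]; exact (φ_act_right hf).symm, (hα m).symm⟩
  refine ⟨α.act g.inv m hdm, ⟨α.act g.inv a hda, ?_, ?_⟩, ⟨α.act g.inv b hdb, ?_, ?_⟩⟩
  · have := act_left_eq_right hdf hda ha
    rwa [act_inv_act] at this
  · subst hm
    rw [α.act_comp g.inv _ a ha hdf hda hdm (act_left_eq_right hdf hda ha)]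
    congr 1
    exact (act_inv_act hf hdf).symm
  · have := act_left_eq_right hdk hdb hb
    rwa [act_inv_act] at this
  · subst hm'
    rw [α.act_comp g.inv _ b hb hdk hdb hdm (act_left_eq_right hdk hdb hb)]
    congr 1
    exact (act_inv_act hk hdk).symm

end Groupoid

section Induced

variable {G : Type u₁} [Groupoid.{v₁} G] {H : Type u₂} [Category.{v₂} H] (α : CatAction G H)

open Classical in
/-- The map `h ↦ S_{α_g(h)}` for `h ∈ H^g` and `h ↦ 0` otherwise. -/
def indRep (g : Mor G) (h : Mor H) : CatCStar H :=
  if hd : α.Dom g h then CatCStar.S (α.act g h hd) else 0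

variable {α}

theorem indRep_of_dom {g : Mor G} {h : Mor H} (hd : α.Dom g h) :
    α.indRep g h = CatCStar.S (α.act g h hd) := dif_pos hd

theorem indRep_of_not {g : Mor G} {h : Mor H} (hd : ¬ α.Dom g h) : α.indRep g h = 0 := dif_neg hd

theorem IsRegular.dom_iff_of_comp (hα : α.IsRegular) {g : Mor G} {f k : Mor H}
    (h : f.left = k.right) : α.Dom g f ↔ α.Dom g k := by
  have h1 := hα f
  have h2 := hα k
  unfold Dom
  rw [← h1, ← h2, h, ← h2]

theorem isCatRep_indRep (hα : α.IsRegular) (g : Mor G) : IsCatRep (α.indRep g) := by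
  have hS := CatCStar.isCatRep_S (C := H)
  constructor
  · intro f
    by_cases hf : α.Dom g f
    · rw [indRep_of_dom hf]; exact hS.partialIsometry _
    · simp [indRep_of_not hf]
  · intro f k h
    by_cases hf : α.Dom g f
    · have hk := (hα.dom_iff_of_comp h).1 hf
      have hfk : α.Dom g (Mor.comp f k h) :=
        ⟨hf.1, (hα (Mor.comp f k h)).symm⟩
      rw [indRep_of_dom hf, indRep_of_dom hk, indRep_of_dom hfk,
        hS.mul_of_comp _ _ (act_left_eq_right hf hk h),
        α.act_comp g f k h hf hk hfk (act_left_eq_right hf hk h)]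
    · have hfk : ¬ α.Dom g (Mor.comp f k h) := fun hd => hf ⟨hd.1, (hα f).symm⟩
      rw [indRep_of_not hf, indRep_of_not hfk, zero_mul]
  · intro f k h
    by_cases hf : α.Dom g f
    · by_cases hk : α.Dom g k
      · rw [indRep_of_dom hf, indRep_of_dom hk]
        exact hS.mul_of_not_comp _ _ fun e => h (left_eq_right_of_act hf hk e)
      · rw [indRep_of_not hk, mul_zero]
    · rw [indRep_of_not hf, zero_mul]
  · intro f k
    by_cases hf : α.Dom g f
    · by_cases hk : α.Dom g k
      · rw [indRep_of_dom hf, indRep_of_dom hk]; exact hS.commute_initial _ _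
      · simp [indRep_of_not hk]
    · simp [indRep_of_not hf]
  · intro f k
    by_cases hf : α.Dom g f
    · by_cases hk : α.Dom g k
      · rw [indRep_of_dom hf, indRep_of_dom hk]; exact hS.commute_final _ _
      · simp [indRep_of_not hk]
    · simp [indRep_of_not hf]
  · intro f k
    by_cases hf : α.Dom g f
    · by_cases hk : α.Dom g k
      · rw [indRep_of_dom hf, indRep_of_dom hk]; exact hS.commute_initial_final _ _
      · simp [indRep_of_not hk]
    · simp [indRep_of_not hf]
  · intro f k h
    by_cases hf : α.Dom g f
    · by_cases hk : α.Dom g k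
      · rw [indRep_of_dom hf, indRep_of_dom hk]; exact hS.disjoint _ _ (disj_act hα hf hk h)
      · simp [indRep_of_not hk]
    · simp [indRep_of_not hf]
  · intro f k h
    by_cases hf : α.Dom g f
    · have hk := (hα.dom_iff_of_comp h).1 hf
      rw [indRep_of_dom hf, indRep_of_dom hk]
      exact hS.initial_mul_final _ _ (act_left_eq_right hf hk h)
    · have hk : ¬ α.Dom g k := fun hd => hf ((hα.dom_iff_of_comp h).2 hd)
      simp [indRep_of_not hk]

/-- The *-endomorphism of `C*(H)` with `S_h ↦ S_{α_g(h)}` for `h ∈ H^g` and `S_h ↦ 0` otherwise. -/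
def indHom (hα : α.IsRegular) (g : Mor G) : CatCStar H →⋆ₙₐ[ℂ] CatCStar H :=
  CatCStar.lift (α.indRep g) (isCatRep_indRep hα g)

variable (α) in
/-- The closed *-subalgebra `C*(H^g)` of `C*(H)` generated by `{S_h : h ∈ H^g}`. -/
def indDom (g : Mor G) : NonUnitalStarSubalgebra ℂ (CatCStar H) :=
  (NonUnitalStarAlgebra.adjoin ℂ {x | ∃ h, α.Dom g h ∧ CatCStar.S h = x}).topologicalClosure

theorem indHom_S_of_dom (hα : α.IsRegular) {g : Mor G} {h : Mor H} (hd : α.Dom g h) :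
    indHom hα g (CatCStar.S h) = CatCStar.S (α.act g h hd) :=
  (CatCStar.lift_S _ _ _).trans (indRep_of_dom hd)

theorem indHom_S_of_not (hα : α.IsRegular) {g : Mor G} {h : Mor H} (hd : ¬ α.Dom g h) :
    indHom hα g (CatCStar.S h) = 0 :=
  (CatCStar.lift_S _ _ _).trans (indRep_of_not hd)

theorem indDom_congr {s t : Mor G} (h : s.left = t.left) : α.indDom s = α.indDom t := by
  unfold indDom Dom; rw [h]

theorem S_mem_indDom {g : Mor G} {h : Mor H} (hd : α.Dom g h) : CatCStar.S h ∈ α.indDom g :=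
  NonUnitalStarSubalgebra.le_topologicalClosure _
    (NonUnitalStarAlgebra.subset_adjoin ℂ _ ⟨h, hd, rfl⟩)

theorem isClosed_indDom (g : Mor G) : IsClosed (α.indDom g : Set (CatCStar H)) :=
  NonUnitalStarSubalgebra.isClosed_topologicalClosure _

theorem indHom_mem (hα : α.IsRegular) (g : Mor G) (a : CatCStar H) :
    indHom hα g a ∈ α.indDom g.inv := by
  refine CatCStar.mem_of_closed ((α.indDom g.inv).comap (indHom hα g)) ?_ (fun f => ?_) a
  · exact (isClosed_indDom g.inv).preimage (map_continuous (indHom hα g))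
  · change indHom hα g (CatCStar.S f) ∈ α.indDom g.inv
    by_cases hf : α.Dom g f
    · rw [indHom_S_of_dom hα hf]
      exact S_mem_indDom (dom_act hf rfl)
    · rw [indHom_S_of_not hα hf]; exact zero_mem _

theorem indHom_comp (hα : α.IsRegular) (s t : Mor G) (h : s.left = t.right) (a : CatCStar H) :
    indHom hα (Mor.comp s t h) a = indHom hα s (indHom hα t a) := by
  have : indHom hα (Mor.comp s t h) = (indHom hα s).comp (indHom hα t) := by
    refine CatCStar.hom_ext fun f => ?_
    rw [NonUnitalStarAlgHom.comp_apply]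
    by_cases hf : α.Dom t f
    · have hf' : α.Dom (Mor.comp s t h) f := hf
      rw [indHom_S_of_dom hα hf', indHom_S_of_dom hα hf, indHom_S_of_dom hα (dom_act hf h),
        α.act_act s t h f hf (dom_act hf h) hf']
    · have hf' : ¬ α.Dom (Mor.comp s t h) f := hf
      rw [indHom_S_of_not hα hf', indHom_S_of_not hα hf, map_zero]
  rw [this]; rfl

theorem indHom_not_comp (hα : α.IsRegular) (s t : Mor G) (h : s.left ≠ t.right)
    (a : CatCStar H) : indHom hα s (indHom hα t a) = 0 := by
  have : (indHom hα s).comp (indHom hα t) = 0 := by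
    refine CatCStar.hom_ext fun f => ?_
    rw [NonUnitalStarAlgHom.comp_apply]
    by_cases hf : α.Dom t f
    · rw [indHom_S_of_dom hα hf, indHom_S_of_not hα fun hd => h (hd.1.trans (φ_act_right hf))]
      rfl
    · rw [indHom_S_of_not hα hf, map_zero]; rfl
  exact DFunLike.congr_fun this a

theorem indHom_unit (hα : α.IsRegular) (g : Mor G) {a : CatCStar H} (ha : a ∈ α.indDom g) :
    indHom hα (Mor.unit g.left) a = a := by
  let K : NonUnitalStarSubalgebra ℂ (CatCStar H) :=
    NonUnitalStarAlgHom.equalizer (indHom hα (Mor.unit g.left))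
      (NonUnitalStarAlgHom.id ℂ (CatCStar H))
  have hK : IsClosed (K : Set (CatCStar H)) :=
    isClosed_eq (map_continuous (indHom hα (Mor.unit g.left))) continuous_id
  refine NonUnitalStarSubalgebra.topologicalClosure_minimal _ (t := K) ?_ hK ha
  refine NonUnitalStarAlgebra.adjoin_le ?_
  rintro _ ⟨h, hd, rfl⟩
  change indHom hα (Mor.unit g.left) (CatCStar.S h) = CatCStar.S h
  have hd' : α.Dom (Mor.unit g.left) h := hd
  rw [indHom_S_of_dom hα hd', act_unit']

theorem indHom_inv_indHom (hα : α.IsRegular) (g : Mor G) {a : CatCStar H}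
    (ha : a ∈ α.indDom g) : indHom hα g.inv (indHom hα g a) = a := by
  rw [← indHom_comp hα g.inv g rfl, Mor.inv_comp, indHom_unit hα g ha]

theorem range_indHom (hα : α.IsRegular) (g : Mor G) :
    Set.range (indHom hα g) = α.indDom g.inv := by
  refine Set.Subset.antisymm ?_ fun a ha => ⟨indHom hα g.inv a, ?_⟩
  · rintro _ ⟨a, rfl⟩; exact indHom_mem hα g a
  · have := indHom_inv_indHom hα g.inv ha
    rwa [Mor.inv_inv] at this

/-- The quasi action `α̃` of `G` on `C*(H)` induced by a regular action `α` of `G` on `H`. -/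
def quasiAction (hα : α.IsRegular) : QuasiAction G (CatCStar H) where
  hom := indHom hα
  dom := α.indDom
  isClosed_dom := isClosed_indDom
  bijOn_dom g := by
    refine ⟨fun a _ => ⟨a, rfl⟩, fun a ha b hb hab => ?_, ?_⟩
    · rw [← indHom_inv_indHom hα g ha, ← indHom_inv_indHom hα g hb]
      exact congrArg _ hab
    · intro b hb
      rw [range_indHom] at hb
      refine ⟨indHom hα g.inv b, ?_, ?_⟩
      · have := indHom_mem hα g.inv b
        rwa [Mor.inv_inv] at this
      · have := indHom_inv_indHom hα g.inv hb
        rwa [Mor.inv_inv] at this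
  range_eq_dom s t h := by
    rw [range_indHom, indDom_congr (s := t.inv) (t := s) h.symm]
  dom_comp _ _ _ := indDom_congr rfl
  hom_comp := indHom_comp hα
  hom_not_comp := indHom_not_comp hα

end Induced

section Regular

variable {G : Type u₁} [Category.{v₁} G] {H : Type u₂} [Category.{v₂} H] (α : CatAction G H)

/-- The property `φ(s(h)) = φ(t(h))` of morphisms of `H`. -/
def regProp : MorphismProperty H := fun a b _ => α.φ a = α.φ b

instance : α.regProp.IsMultiplicative where
  id_mem _ := rfl
  comp_mem _ _ h h' := Eq.trans h h'

/-- The subcategory `H_r = {h ∈ H : φ(s(h)) = φ(t(h))}` of `H`. -/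
abbrev Reg : Type u₂ := WideSubcategory α.regProp

/-- A morphism `h` of `H` with `φ(s(h)) = φ(t(h))` as a morphism of `H_r`. -/
@[reducible] def toReg (h : Mor H) (hh : α.φ h.left = α.φ h.right) : Mor α.Reg :=
  ⟨⟨h.left⟩, ⟨h.right⟩, ⟨h.hom, hh⟩⟩

variable {α} in
/-- The inclusion of `H_r` into `H`. -/
@[reducible] def ofReg (h : Mor α.Reg) : Mor H := ⟨h.left.obj, h.right.obj, h.hom.hom⟩

theorem toReg_ofReg (h : Mor α.Reg) (hh) : α.toReg (ofReg h) hh = h := rfl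

variable {α} in
theorem ofReg_injective {h k : Mor α.Reg} (e : ofReg h = ofReg k) : h = k := by
  have : ∀ (a b : Mor H) (ha hb), a = b → α.toReg a ha = α.toReg b hb := by
    rintro a _ _ _ rfl; rfl
  exact this (ofReg h) (ofReg k) h.hom.property k.hom.property e

theorem ofReg_comp (f k : Mor α.Reg) (h : f.left = k.right) :
    ofReg (Mor.comp f k h) = Mor.comp (ofReg f) (ofReg k) (congrArg WideSubcategory.obj h) := by
  obtain ⟨a, b, f⟩ := f
  obtain ⟨c, d, k⟩ := k
  obtain rfl : a = d := h
  simp [ofReg, Mor.comp]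

/-- The (regular) action of `G` on `H_r` given by restricting `α`. -/
def restrict : CatAction G α.Reg where
  φ u := α.φ u.obj
  φ_surjective x := by
    obtain ⟨u, rfl⟩ := α.φ_surjective x
    exact ⟨⟨u⟩, rfl⟩
  act g h hd := α.toReg (α.act g (ofReg h) hd)
    ((φ_act_left hd).trans (φ_act_right hd).symm)
  act_left g h hd hd' := ofReg_injective (α.act_left g (ofReg h) hd hd')
  act_right g h hd hd' := ofReg_injective (α.act_right g (ofReg h) hd hd')
  φ_act_unit g u hd := α.φ_act_unit g u.obj hd
  act_unit h hd := ofReg_injective (α.act_unit (ofReg h) hd)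
  act_act g' g hg h hd hd' hd'' := ofReg_injective (α.act_act g' g hg (ofReg h) hd hd' hd'')
  act_comp g h' h hh hd' hd hd'' hh' := ofReg_injective (by
    refine Eq.trans ?_ (ofReg_comp α _ _ hh').symm
    have e : (ofReg h').left = (ofReg h).right := congrArg WideSubcategory.obj hh
    have hd₃ : α.Dom g (Mor.comp (ofReg h') (ofReg h) e) := hd''
    refine Eq.trans ?_ (α.act_comp g (ofReg h') (ofReg h) e hd' hd hd₃ (congrArg WideSubcategory.obj hh'))
    exact act_congr rfl (ofReg_comp α h' h hh) _ _)

theorem restrict_isRegular : α.restrict.IsRegular := fun h => h.hom.property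

end Regular

section SemiDirect

variable {G : Type u₁} [Groupoid.{v₁} G] {H : Type u₂} [Category.{v₂} H] (α : CatAction G H)

/-- The set `H ×_α G` of pairs `(h, g)` with `t(g) = φ(s(h)) = φ(t(h))`. -/
@[ext] structure SemiPair where
  /-- The component in `H`. -/
  h : Mor H
  /-- The component in `G`. -/
  g : Mor G
  φ_left : g.right = α.φ h.left
  φ_right : g.right = α.φ h.right

namespace SemiPair

variable {α}

theorem dom_inv (p : α.SemiPair) : α.Dom p.g.inv p.h :=
  ⟨p.φ_right, p.φ_right.symm.trans p.φ_left⟩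

/-- The source `α_{g⁻¹}(s(h))` of `(h, g)`. -/
def src (p : α.SemiPair) : H := (α.act p.g.inv (Mor.unit p.h.left) p.dom_inv.unit_left).left

/-- The target `t(h)` of `(h, g)`. -/
def tgt (p : α.SemiPair) : H := p.h.right

theorem src_eq (p : α.SemiPair) : p.src = (α.act p.g.inv p.h p.dom_inv).left := by
  unfold src; rw [α.act_left p.g.inv p.h p.dom_inv p.dom_inv.unit_left]

theorem φ_src (p : α.SemiPair) : α.φ p.src = p.g.left := by
  rw [src_eq]; exact φ_act_left p.dom_inv

theorem φ_tgt (p : α.SemiPair) : α.φ p.tgt = p.g.right := p.φ_right.symm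

/-- The unit `(u, φ(u))`. -/
def one (u : H) : α.SemiPair := ⟨Mor.unit u, Mor.unit (α.φ u), rfl, rfl⟩

theorem src_one (u : H) : (one u : α.SemiPair).src = u := by
  have hd : α.Dom (Mor.unit (α.φ u)) (Mor.unit u) := ⟨rfl, rfl⟩
  have e : (Mor.unit (α.φ u)).inv = Mor.unit (α.φ u) := by simp [Mor.inv, Mor.unit]
  have : α.act (Mor.unit (α.φ u)).inv (Mor.unit u) ⟨rfl, rfl⟩ = Mor.unit u :=
    (act_congr e rfl _ hd).trans (act_unit' hd)
  exact congrArg Quiver.Total.left this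

theorem tgt_one (u : H) : (one u : α.SemiPair).tgt = u := rfl

theorem g_comp (p q : α.SemiPair) (e : p.src = q.tgt) : p.g.left = q.g.right := by rw [← φ_src, e, φ_tgt]

theorem dom_comp (p q : α.SemiPair) (e : p.src = q.tgt) : α.Dom p.g q.h := ⟨(g_comp p q e).trans q.φ_right, q.φ_right.symm.trans q.φ_left⟩

theorem h_comp (p q : α.SemiPair) (e : p.src = q.tgt) : p.h.left = (α.act p.g q.h (dom_comp p q e)).right := by
  have h1 := dom_comp p q e
  have h2 := p.dom_inv.unit_left
  apply Mor.unit_injective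
  rw [← α.act_right p.g q.h h1 h1.unit_right, ← act_act_inv h2 (dom_act h2 rfl)]
  refine act_congr rfl ?_ _ _
  rw [α.act_left p.g.inv p.h p.dom_inv h2]
  change Mor.unit _ = Mor.unit q.tgt
  rw [← e, src_eq]

/-- The product `(h, g)(h', g') = (h α_g(h'), g g')`, defined if `s(h, g) = t(h', g')`. -/
def mul (p q : α.SemiPair) (e : p.src = q.tgt) : α.SemiPair where
  h := Mor.comp p.h (α.act p.g q.h (dom_comp p q e)) (h_comp p q e)
  g := Mor.comp p.g q.g (g_comp p q e)
  φ_left := (φ_act_left (dom_comp p q e)).symm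
  φ_right := p.φ_right

theorem tgt_mul (p q : α.SemiPair) (e : p.src = q.tgt) : (mul p q e).tgt = p.tgt := rfl

theorem src_mul (p q : α.SemiPair) (e : p.src = q.tgt) : (mul p q e).src = q.src := by
  have hd := (mul p q e).dom_inv.unit_left
  have h1 := dom_comp p q e
  have h2 : α.Dom p.g.inv (Mor.unit (mul p q e).h.left) := hd
  have h3 : α.act p.g.inv (Mor.unit (mul p q e).h.left) h2 = Mor.unit q.h.left := by
    have := act_inv_act h1.unit_left (dom_act (g' := p.g.inv) h1.unit_left rfl)
    rw [← this]
    exact act_congr rfl (α.act_left p.g q.h h1 h1.unit_left).symm _ _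
  unfold src
  congr 1
  have hg : (mul p q e).g.inv = Mor.comp q.g.inv p.g.inv (g_comp p q e).symm :=
    Mor.inv_comp_rev _ _ (g_comp p q e)
  have h4 : α.Dom q.g.inv (α.act p.g.inv (Mor.unit (mul p q e).h.left) h2) := by
    rw [h3]; exact q.dom_inv.unit_left
  have h5 : α.Dom (Mor.comp q.g.inv p.g.inv (g_comp p q e).symm)
      (Mor.unit (mul p q e).h.left) := hd
  rw [act_congr hg rfl hd h5, ← α.act_act q.g.inv p.g.inv (g_comp p q e).symm _ h2 h4 h5]
  exact act_congr rfl h3 _ _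

theorem mul_one (p : α.SemiPair) {u : H} (e : p.src = (one u : α.SemiPair).tgt) :
    mul p (one u) e = p := by
  have h1 := h_comp p (one u) e
  have hd := dom_comp p (one u) e
  have hu : α.act p.g (Mor.unit u) hd = Mor.unit p.h.left := by
    have := α.act_right p.g (Mor.unit u) hd hd
    rw [this]; exact congrArg Mor.unit h1.symm
  refine SemiPair.ext ?_ (Mor.comp_unit p.g (g_comp p (one u) e))
  refine Eq.trans ?_ (Mor.comp_unit p.h rfl)
  change Mor.comp p.h (α.act p.g (Mor.unit u) hd) h1 = _
  congr 1

theorem one_mul (p : α.SemiPair) {u : H} (e : (one u : α.SemiPair).src = p.tgt) :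
    mul (one u) p e = p := by
  have h1 := h_comp (one u) p e
  have hd := dom_comp (one u) p e
  have hu : α.act (Mor.unit (α.φ u)) p.h hd = p.h := act_unit' hd
  refine SemiPair.ext ?_ (Mor.unit_comp p.g (g_comp (one u) p e))
  refine Eq.trans ?_ (Mor.unit_comp p.h (x := u) (by rw [src_one] at e; exact e))
  change Mor.comp (Mor.unit u) (α.act (Mor.unit (α.φ u)) p.h hd) h1 = _
  congr 1

theorem mul_assoc (p q r : α.SemiPair) (e : p.src = q.tgt) (e' : q.src = r.tgt)
    (e₁ : (mul p q e).src = r.tgt) (e₂ : p.src = (mul q r e').tgt) :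
    mul (mul p q e) r e₁ = mul p (mul q r e') e₂ := by
  have hd := dom_comp p q e
  have hdr := dom_comp q r e'
  have hdd := dom_act (g' := p.g) hdr (g_comp p q e)
  have hd₁ := dom_comp (mul p q e) r e₁
  have hd₂ := dom_comp p (mul q r e') e₂
  refine SemiPair.ext ?_ (Mor.comp_assoc p.g q.g r.g (g_comp p q e) (g_comp q r e'))
  have h1 : α.act (mul p q e).g r.h hd₁ = α.act p.g (α.act q.g r.h hdr) hdd :=
    (α.act_act p.g q.g (g_comp p q e) r.h hdr hdd hd₁).symm
  have hc := act_left_eq_right hd hdd (h_comp q r e')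
  have h2 : α.act p.g (mul q r e').h hd₂ =
      Mor.comp (α.act p.g q.h hd) (α.act p.g (α.act q.g r.h hdr) hdd) hc :=
    α.act_comp p.g q.h (α.act q.g r.h hdr) (h_comp q r e') hd hdd hd₂ hc
  change Mor.comp (mul p q e).h (α.act (mul p q e).g r.h hd₁) (h_comp _ _ e₁) =
    Mor.comp p.h (α.act p.g (mul q r e').h hd₂) (h_comp _ _ e₂)
  have e3 : (mul p q e).h.left = (α.act p.g (α.act q.g r.h hdr) hdd).right := by
    rw [← h1]; exact h_comp _ _ e₁
  have e4 : p.h.left =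
      (Mor.comp (α.act p.g q.h hd) (α.act p.g (α.act q.g r.h hdr) hdd) hc).right :=
    h_comp p q e
  trans Mor.comp (mul p q e).h (α.act p.g (α.act q.g r.h hdr) hdd) e3
  · congr 1
  trans Mor.comp p.h (Mor.comp (α.act p.g q.h hd) (α.act p.g (α.act q.g r.h hdr) hdd) hc) e4
  · exact Mor.comp_assoc _ _ _ _ _
  · congr 1; exact h2.symm

end SemiPair

/-- The semi-direct product category `H ×_α G`. Its objects are those of `H`, and its morphisms
from `a` to `b` are the pairs `(h, g)` in `H ×_α G` with source `a` and target `b`. -/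
structure SemiProd (_α : CatAction G H) where
  /-- The underlying unit of `H`. -/
  obj : H

instance : Category.{max u₁ v₁ u₂ v₂} α.SemiProd where
  Hom a b := {p : α.SemiPair // p.src = a.obj ∧ p.tgt = b.obj}
  id a := ⟨SemiPair.one a.obj, SemiPair.src_one a.obj, rfl⟩
  comp f k := ⟨SemiPair.mul k.1 f.1 (k.2.1.trans f.2.2.symm),
    (SemiPair.src_mul _ _ _).trans f.2.1, k.2.2⟩
  id_comp {a _} f := Subtype.ext (SemiPair.mul_one f.1 (u := a.obj) f.2.1)
  comp_id {_ b} f := Subtype.ext (SemiPair.one_mul f.1 (u := b.obj)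
    ((SemiPair.src_one b.obj).trans f.2.2.symm))
  assoc f k l := Subtype.ext (SemiPair.mul_assoc l.1 k.1 f.1 (l.2.1.trans k.2.2.symm)
    (k.2.1.trans f.2.2.symm)
    ((SemiPair.src_mul _ _ _).trans (k.2.1.trans f.2.2.symm)) (l.2.1.trans k.2.2.symm)).symm

variable {α}

/-- The pair `(h, g)` as a morphism of `H ×_α G`. -/
def SemiPair.toMor (p : α.SemiPair) : Mor α.SemiProd := 
  ⟨⟨p.src⟩, ⟨p.tgt⟩, (⟨p, rfl, rfl⟩ : {q : α.SemiPair // q.src = p.src ∧ q.tgt = p.tgt})⟩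

/-- The component `h` of `(h, g)` as a morphism of `H_r`. -/
def SemiPair.hr (p : α.SemiPair) : Mor α.Reg := α.toReg p.h (p.φ_left.symm.trans p.φ_right)

theorem SemiPair.S_hr_mem (p : α.SemiPair) :
    CatCStar.S p.hr ∈ (quasiAction α.restrict_isRegular).dom p.g.inv :=
  S_mem_indDom (α := α.restrict) ⟨p.φ_right, p.φ_right.symm.trans p.φ_left⟩

end SemiDirect

end CatAction

end

/-!
The generators multiply in `C*(H ×_α G)` as the elements `S_h g` do in the crossed product, so
`S_{(h, g)} ↦ S_h g` defines a *-homomorphism `Φ` by universality (`CatAction.isCatRep_crossedS`).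
For this the initial and final projections of `S_h g` are computed: they are those of
`S_{α_{g⁻¹}(h)}` and `S_h`, placed at the units `s(g)` and `t(g)`. Hence the relations between them
are those of `C*(H_r)` at equal units, and trivial at different units.

In the other direction one would like to send `a g` to `π(a) V_g`, where `π(S_h) = S_{(h, φ(t(h)))}`
and `V_g` is the sum of the partial isometries `S_{(u, g)}` over the units `u` with `φ(u) = t(g)`.
There may be infinitely many of those, but the sum converges strictly and defines a multiplier of
`C*(H ×_α G)` (`IsMultFamily.sum`, `CatAction.V`), because the units generate `C*(H ×_α G)` as a
closed right ideal (`CatCStar.mem_of_closed_rightIdeal`) and a given unit meets at most one of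
the summands from either side. Multipliers are determined by their products with the units, which
reduces the covariance relation `V_g π(a) = π(α̃_g(a)) V_g` and the relations between the `V_g` to
computations in the category `H ×_α G` (`CatAction.isCovariant_π_V`).

The integrated form `Ψ` of the covariant pair is defined on the crossed product with values in the
multiplier algebra. The norm of the crossed product refers to representations on Hilbert spaces, so
continuity of `Ψ` needs that the norm of an element of a unital C*-algebra is attained in some
representation (`exists_rep_norm_le`), which follows from the GNS construction. Since `Ψ ∘ Φ` is the
inclusion of `C*(H ×_α G)` in its multiplier algebra, `Φ` is isometric; its range is closed, and it
contains every `a g`, hence is everything.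
-/

/-! ### Norms in representations on Hilbert spaces -/

section States

open scoped ComplexOrder

variable {M : Type*} [CStarAlgebra M]

/-- A norm-one functional with `F 1 = 1` is real on selfadjoint elements: otherwise `F (b + i n)`
would outgrow `‖b + i n‖` for a suitable real number `n`. -/
theorem im_apply_eq_zero_of_norm_le_one {F : M →L[ℂ] ℂ} (hF : ‖F‖ ≤ 1) (h1 : F 1 = 1) {b : M}
    (hb : IsSelfAdjoint b) : (F b).im = 0 := by
  have key : ∀ n : ℝ, (F b).im ^ 2 + 2 * n * (F b).im ≤ ‖b‖ ^ 2 := by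
    intro n
    have hs : star (b + (n * Complex.I) • (1 : M)) * (b + (n * Complex.I) • (1 : M)) =
        b * b + ((n ^ 2 : ℝ) : ℂ) • (1 : M) := by
      have e : ((starRingEnd ℂ) (n * Complex.I)) = -(n * Complex.I) := by simp
      rw [star_add, star_smul, star_one, hb.star_eq]
      have e2 : -(n * Complex.I * (n * Complex.I)) = ((n ^ 2 : ℝ) : ℂ) := by
        push_cast
        linear_combination (-(n : ℂ) ^ 2) * Complex.I_sq
      rw [← e2]
      simp only [RCLike.star_def, e, smul_add, mul_add, add_mul, smul_mul_assoc, mul_smul_comm,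
        one_mul, mul_one, neg_smul, neg_mul, smul_neg, smul_smul]
      abel
    have hn : ‖b + (n * Complex.I) • (1 : M)‖ ^ 2 ≤ ‖b‖ ^ 2 + n ^ 2 := by
      rw [sq, ← CStarRing.norm_star_mul_self, hs]
      refine (norm_add_le _ _).trans (add_le_add ?_ ?_)
      · exact (norm_mul_le _ _).trans_eq (sq _).symm
      · rw [norm_smul, Complex.norm_real, Real.norm_of_nonneg (sq_nonneg n)]
        rcases subsingleton_or_nontrivial M with h | h
        · rw [Subsingleton.elim (1 : M) 0, norm_zero, mul_zero]; positivity
        · rw [CStarRing.norm_one, mul_one]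
    have hFn : F (b + (n * Complex.I) • (1 : M)) = F b + n * Complex.I := by
      rw [map_add, map_smul, h1, smul_eq_mul, mul_one]
    have h2 : ‖F b + n * Complex.I‖ ≤ ‖b + (n * Complex.I) • (1 : M)‖ := by
      rw [← hFn]
      exact (F.le_opNorm _).trans (mul_le_of_le_one_left (norm_nonneg _) hF)
    have h3 : ((F b).im + n) ^ 2 ≤ ‖F b + n * Complex.I‖ ^ 2 := by
      have := Complex.abs_im_le_norm (F b + n * Complex.I)
      rw [← sq_abs]
      simp only [Complex.add_im, Complex.mul_im, Complex.ofReal_re, Complex.I_im, mul_one,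
        Complex.ofReal_im, Complex.I_re, mul_zero, add_zero] at this
      exact pow_le_pow_left₀ (abs_nonneg _) this 2
    have h4 := pow_le_pow_left₀ (norm_nonneg _) h2 2
    linarith [(h3.trans h4).trans hn, add_sq (F b).im n]
  -- `key` bounds an affine function of `n` from above, so the slope vanishes.
  by_contra h0
  have := key ((‖b‖ ^ 2 + 1) / (2 * (F b).im))
  have e : 2 * ((‖b‖ ^ 2 + 1) / (2 * (F b).im)) * (F b).im = ‖b‖ ^ 2 + 1 := by field_simp
  rw [e] at this
  nlinarith [sq_nonneg (F b).im]

variable [PartialOrder M] [StarOrderedRing M]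

/-- A norm-one functional with `F 1 = 1` is positive: for `0 ≤ b` one has `‖‖b‖ - b‖ ≤ ‖b‖`, whence
`|‖b‖ - F b| ≤ ‖b‖`. -/
theorem apply_nonneg_of_norm_le_one {F : M →L[ℂ] ℂ} (hF : ‖F‖ ≤ 1) (h1 : F 1 = 1) {b : M}
    (hb : 0 ≤ b) : 0 ≤ F b := by
  have him := im_apply_eq_zero_of_norm_le_one hF h1 (IsSelfAdjoint.of_nonneg hb)
  have hle : b ≤ algebraMap ℝ M ‖b‖ := IsSelfAdjoint.le_algebraMap_norm_self
  have h2 : ‖algebraMap ℝ M ‖b‖ - b‖ ≤ ‖b‖ := by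
    have h3 : algebraMap ℝ M ‖b‖ - b ≤ algebraMap ℝ M ‖b‖ := sub_le_self _ hb
    exact (CStarAlgebra.norm_le_iff_le_algebraMap _ (norm_nonneg b) (sub_nonneg.2 hle)).2 h3
  have h4 : F (algebraMap ℝ M ‖b‖ - b) = ‖b‖ - F b := by
    rw [map_sub, Algebra.algebraMap_eq_smul_one, ← Complex.coe_smul, map_smul, h1, smul_eq_mul,
      mul_one]
  have h5 : ‖(‖b‖ : ℂ) - F b‖ ≤ ‖b‖ := by
    rw [← h4]
    exact ((F.le_opNorm _).trans (mul_le_of_le_one_left (norm_nonneg _) hF)).trans h2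
  have h6 := (Complex.re_le_norm _).trans h5
  rw [Complex.sub_re, Complex.ofReal_re] at h6
  rw [Complex.le_def]
  exact ⟨by simpa using h6, him.symm⟩

/-- The norm of a positive element is attained by a state: a character of the commutative
C*-algebra generated by `a` attains it, and extends by the Hahn–Banach theorem. -/
theorem exists_state_apply_eq_norm [Nontrivial M] {a : M} (ha : 0 ≤ a) :
    ∃ f : M →ₚ[ℂ] ℂ, f 1 = 1 ∧ f a = ‖a‖ := by
  have hsa : IsSelfAdjoint a := IsSelfAdjoint.of_nonneg ha
  have : IsStarNormal a := hsa.isStarNormal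
  have hmem : (‖a‖ : ℂ) ∈ spectrum ℂ a := by
    have := CStarAlgebra.norm_mem_spectrum_of_nonneg ha
    exact spectrum.algebraMap_mem ℂ this
  let S := StarAlgebra.elemental ℂ a
  let a' : S := ⟨a, StarAlgebra.elemental.self_mem ℂ a⟩
  have hmem' : (‖a‖ : ℂ) ∈ spectrum ℂ a' := by
    rwa [StarSubalgebra.spectrum_eq (hS := StarAlgebra.elemental.isClosed ℂ a)]
  -- Since `‖a‖` lies in the spectrum of `a`, some character takes this value at `a`.
  obtain ⟨χ, hχ⟩ := WeakDual.CharacterSpace.mem_spectrum_iff_exists.1 hmem'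
  let χ' : StrongDual ℂ S := WeakDual.toStrongDual (χ : WeakDual ℂ S)
  have hχ' : ∀ x, χ' x = χ x := fun x => rfl
  have hn : ‖χ'‖ ≤ 1 := by
    refine ContinuousLinearMap.opNorm_le_bound _ zero_le_one fun x => ?_
    rw [one_mul]
    exact spectrum.norm_le_norm_of_mem (AlgHom.apply_mem_spectrum χ x)
  obtain ⟨F, hF, hFn⟩ := exists_extension_norm_eq
    (StarAlgebra.elemental ℂ a).toSubalgebra.toSubmodule χ'
  have h1 : F 1 = 1 := (hF (1 : S)).trans (map_one χ)
  refine ⟨PositiveLinearMap.mk₀ F.toLinearMap fun b hb =>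
    apply_nonneg_of_norm_le_one (hFn.trans_le hn) h1 hb, h1, ?_⟩
  exact (hF a').trans hχ

end States

open scoped ComplexOrder in
/-- Every element of a unital C*-algebra is represented without loss of norm on some Hilbert
space. -/
theorem exists_rep_norm_le {M : Type w} [CStarAlgebra M] (x : M) :
    ∃ (K : Type w) (_ : NormedAddCommGroup K) (_ : InnerProductSpace ℂ K) (_ : CompleteSpace K)
      (ρ : M →⋆ₙₐ[ℂ] (K →L[ℂ] K)), ‖x‖ ≤ ‖ρ x‖ := by
  let _ : PartialOrder M := CStarAlgebra.spectralOrder M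
  have : StarOrderedRing M := CStarAlgebra.spectralOrderedRing M
  rcases subsingleton_or_nontrivial M with h | h
  · refine ⟨(0 : M →ₚ[ℂ] ℂ).GNS, inferInstance, inferInstance, inferInstance,
      (0 : M →ₚ[ℂ] ℂ).gnsNonUnitalStarAlgHom, ?_⟩
    rw [Subsingleton.elim x 0, norm_zero]
    exact norm_nonneg _
  obtain ⟨f, hf1, hfx⟩ := exists_state_apply_eq_norm (star_mul_self_nonneg x)
  refine ⟨f.GNS, inferInstance, inferInstance, inferInstance, f.gnsNonUnitalStarAlgHom, ?_⟩
  have hsq : ∀ y : M, ((‖(f.toPreGNS y : f.GNS)‖ : ℂ)) ^ 2 = f (star y * y) := fun y => by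
    rw [Completion.norm_coe]; exact f.preGNS_norm_sq _
  have h1 : ‖(f.toPreGNS 1 : f.GNS)‖ = 1 := by
    have := hsq 1
    rw [star_one, one_mul, hf1] at this
    have h2 : ‖(f.toPreGNS 1 : f.GNS)‖ ^ 2 = 1 := by exact_mod_cast this
    nlinarith [norm_nonneg (f.toPreGNS 1 : f.GNS)]
  have hx : ‖(f.toPreGNS x : f.GNS)‖ = ‖x‖ := by
    have := hsq x
    rw [hfx, CStarRing.norm_star_mul_self, ← sq] at this
    have h2 : ‖(f.toPreGNS x : f.GNS)‖ ^ 2 = ‖x‖ ^ 2 := by exact_mod_cast this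
    exact (sq_eq_sq₀ (norm_nonneg _) (norm_nonneg _)).1 h2
  have hmul : f.gnsNonUnitalStarAlgHom x (f.toPreGNS 1 : f.GNS) = (f.toPreGNS x : f.GNS) := by
    rw [PositiveLinearMap.gnsNonUnitalStarAlgHom_apply_coe]
    simp
  calc ‖x‖ = ‖f.gnsNonUnitalStarAlgHom x (f.toPreGNS 1 : f.GNS)‖ := by rw [hmul, hx]
    _ ≤ ‖f.gnsNonUnitalStarAlgHom x‖ * ‖(f.toPreGNS 1 : f.GNS)‖ :=
      ContinuousLinearMap.le_opNorm _ _
    _ = _ := by rw [h1, mul_one]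

/-! ### Representations of categories -/

namespace IsCatRep

variable {C : Type u₁} [Category.{v₁} C] {B : Type*} [NonUnitalCStarAlgebra B] {T : Mor C → B}

theorem unit_mul (hT : IsCatRep T) (f : Mor C) : T (Mor.unit f.right) * T f = T f := by
  rw [hT.mul_of_comp _ _ rfl, Mor.unit_comp]

theorem mul_unit (hT : IsCatRep T) (f : Mor C) : T f * T (Mor.unit f.left) = T f := by
  rw [hT.mul_of_comp _ _ rfl, Mor.comp_unit]

/-- Units go to projections: `Q_u P_u = P_u` reads `T_u* = T_u T_u*`. -/
theorem star_unit (hT : IsCatRep T) (x : C) : star (T (Mor.unit x)) = T (Mor.unit x) := by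
  have h1 := hT.initial_mul_final (Mor.unit x) (Mor.unit x) rfl
  have h2 : T (Mor.unit x) * T (Mor.unit x) = T (Mor.unit x) := hT.unit_mul (Mor.unit x)
  have h3 : star (T (Mor.unit x)) * T (Mor.unit x) * star (T (Mor.unit x)) =
      star (T (Mor.unit x)) := by
    simpa [mul_assoc] using congrArg star (hT.partialIsometry (Mor.unit x))
  have h4 : star (T (Mor.unit x)) = T (Mor.unit x) * star (T (Mor.unit x)) := by
    rw [← h1, mul_assoc, ← mul_assoc (T _) (T _), h2, ← mul_assoc, h3]
  rw [h4]
  have := congrArg star h4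
  rw [star_star, star_mul, star_star] at this
  exact this.symm

theorem unit_mul_star (hT : IsCatRep T) (f : Mor C) :
    T (Mor.unit f.left) * star (T f) = star (T f) := by
  rw [← hT.star_unit, ← star_mul, hT.mul_unit]

theorem star_mul_unit (hT : IsCatRep T) (f : Mor C) :
    star (T f) * T (Mor.unit f.right) = star (T f) := by
  rw [← hT.star_unit, ← star_mul, hT.unit_mul]

theorem star_mul_of_ne (hT : IsCatRep T) {f k : Mor C} (h : f.right ≠ k.right) :
    star (T f) * T k = 0 := by
  rw [← hT.star_mul_unit f, ← hT.unit_mul k, mul_assoc, ← mul_assoc (T _) (T _),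
    hT.mul_of_not_comp _ _ (by exact h), zero_mul, mul_zero]

theorem mul_star_of_ne (hT : IsCatRep T) {f k : Mor C} (h : f.left ≠ k.left) :
    T f * star (T k) = 0 := by
  rw [← hT.unit_mul_star k, ← hT.mul_unit f, mul_assoc, ← mul_assoc (T (Mor.unit _)),
    hT.mul_of_not_comp (Mor.unit f.left) _ (by exact h), zero_mul, mul_zero]

/-- Inverse morphisms go to adjoint partial isometries: `Q_f P_k = P_k` for inverse `f`, `k` says that
`T_k T_k*` is the unit projection at `t(k)`, and likewise for `f`; then
`T_k = T_k T_f T_f* = T_f*`. -/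
theorem star_of_inverse (hT : IsCatRep T) {f k : Mor C} (h : f.left = k.right)
    (h' : k.left = f.right) (e : Mor.comp f k h = Mor.unit f.right)
    (e' : Mor.comp k f h' = Mor.unit k.right) : star (T f) = T k := by
  have aux : ∀ {f k : Mor C} (h : f.left = k.right) (h' : k.left = f.right),
      Mor.comp f k h = Mor.unit f.right → Mor.comp k f h' = Mor.unit k.right →
      T k * star (T k) = T (Mor.unit k.right) := by
    intro f k h h' e e'
    have h1 := hT.initial_mul_final f k h
    rw [mul_assoc, ← mul_assoc (T f), hT.mul_of_comp f k h, e, ← mul_assoc, hT.star_mul_unit,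
      ← star_mul, hT.mul_of_comp k f h', e', hT.star_unit] at h1
    exact h1.symm
  have h2 := aux h' h e' e
  have h3 : T k = T k * (T f * star (T f)) := by
    rw [h2, ← h', hT.mul_unit]
  rw [h3, ← mul_assoc, hT.mul_of_comp k f h', e', ← h, hT.unit_mul_star]

end IsCatRep

/-- A closed right ideal of `C*(C)` which contains the units is everything: if `J` is the ideal,
then `J ∩ J*` is a *-subalgebra, and it contains `S_f = S_{t(f)} S_f` and
`S_f* = S_{s(f)} S_f*`. -/
theorem CatCStar.mem_of_closed_rightIdeal {C : Type u₁} [Category.{v₁} C]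
    (J : Submodule ℂ (CatCStar C)) (hJ : IsClosed (J : Set (CatCStar C)))
    (hmul : ∀ b ∈ J, ∀ c, b * c ∈ J) (hu : ∀ x, S (Mor.unit x) ∈ J) (b : CatCStar C) : b ∈ J := by
  let K : NonUnitalStarSubalgebra ℂ (CatCStar C) :=
    { carrier := {b | b ∈ J ∧ star b ∈ J}
      add_mem' := fun ha hb => ⟨add_mem ha.1 hb.1, by rw [star_add]; exact add_mem ha.2 hb.2⟩
      zero_mem' := ⟨zero_mem J, by rw [star_zero]; exact zero_mem J⟩
      mul_mem' := fun ha hb => ⟨hmul _ ha.1 _, by rw [star_mul]; exact hmul _ hb.2 _⟩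
      smul_mem' := fun c _ hb => ⟨J.smul_mem c hb.1, by
        rw [star_smul]; exact J.smul_mem _ hb.2⟩
      star_mem' := fun hb => ⟨hb.2, by rw [star_star]; exact hb.1⟩ }
  have hK : IsClosed (K : Set (CatCStar C)) :=
    hJ.inter (hJ.preimage continuous_star)
  refine (mem_of_closed K hK (fun f => ⟨?_, ?_⟩) b).1
  · rw [← isCatRep_S.unit_mul f]; exact hmul _ (hu _) _
  · rw [← isCatRep_S.unit_mul_star f]; exact hmul _ (hu _) _

/-! ### Multipliers given by infinite sums -/

open scoped MultiplierAlgebra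

section Multiplier

variable {B : Type*} [NonUnitalCStarAlgebra B] {I : Type*}

/-- A family of selfadjoint elements which generates `B` as a closed right ideal. -/
structure IsGeneratingFamily (e : I → B) : Prop where
  star_eq : ∀ i, star (e i) = e i
  mem : ∀ J : Submodule ℂ B, IsClosed (J : Set B) → (∀ b ∈ J, ∀ c, b * c ∈ J) →
    (∀ i, e i ∈ J) → ∀ b, b ∈ J

/-- The injection of a C*-algebra into its multiplier algebra. -/
noncomputable abbrev toMult (B : Type*) [NonUnitalCStarAlgebra B] : B →⋆ₙₐ[ℂ] 𝓜(ℂ, B) :=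
  DoubleCentralizer.coeHom (𝕜 := ℂ)

theorem toMult_injective : Function.Injective (toMult B) := by
  refine (injective_iff_map_eq_zero _).2 fun b hb => ?_
  have h1 : (toMult B b).fst (star b) = 0 := by rw [hb]; rfl
  exact (CStarRing.mul_star_self_eq_zero_iff b).1 h1

/-- Multipliers are determined by their products with a generating family. -/
theorem IsGeneratingFamily.mult_ext {e : I → B} (he : IsGeneratingFamily e) {X Y : 𝓜(ℂ, B)}
    (h : ∀ i, toMult B (e i) * X = toMult B (e i) * Y) : X = Y := by
  -- The adjoints turn the left ideal on which `X` and `Y` agree into a right ideal.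
  let J : Submodule ℂ B :=
    { carrier := {b | toMult B (star b) * X = toMult B (star b) * Y}
      add_mem' := fun {a b} ha hb => by
        simp only [Set.mem_ofPred_eq] at ha hb ⊢
        rw [star_add, map_add, add_mul, add_mul, ha, hb]
      zero_mem' := by simp only [Set.mem_ofPred_eq, star_zero, map_zero, zero_mul]
      smul_mem' := fun c b hb => by
        simp only [Set.mem_ofPred_eq] at hb ⊢
        rw [star_smul, map_smul, smul_mul_assoc, smul_mul_assoc, hb] }
  have hJ : IsClosed (J : Set B) := by
    have hc : Continuous (toMult B) := map_continuous (toMult B)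
    exact isClosed_eq ((hc.comp continuous_star).mul continuous_const)
      ((hc.comp continuous_star).mul continuous_const)
  have hall := he.mem J hJ (fun b hb c => by
    change toMult B (star (b * c)) * X = toMult B (star (b * c)) * Y
    have hb' : toMult B (star b) * X = toMult B (star b) * Y := hb
    rw [star_mul, map_mul, mul_assoc, mul_assoc, hb']) (fun i => by
    change toMult B (star (e i)) * X = toMult B (star (e i)) * Y
    rw [he.star_eq, h])
  have hfst : ∀ y, X.fst y = Y.fst y := fun y => by
    have h1 : toMult B (star (X.fst y - Y.fst y)) * X =
        toMult B (star (X.fst y - Y.fst y)) * Y := hall _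
    have h2 : star (X.fst y - Y.fst y) * X.fst y = star (X.fst y - Y.fst y) * Y.fst y :=
      congrArg (fun Z : 𝓜(ℂ, B) => Z.fst y) h1
    rw [← sub_eq_zero, ← mul_sub, CStarRing.star_mul_self_eq_zero_iff, sub_eq_zero] at h2
    exact h2
  have hsnd : ∀ x, X.snd x = Y.snd x := fun x => by
    rw [← sub_eq_zero, ← CStarRing.mul_star_self_eq_zero_iff, sub_mul, X.central, Y.central,
      hfst, sub_self]
  exact DoubleCentralizer.ext _ _ _ _ (Prod.ext (ContinuousLinearMap.ext hfst)
    (ContinuousLinearMap.ext hsnd))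

theorem IsGeneratingFamily.mult_ext_right {e : I → B} (he : IsGeneratingFamily e) {X Y : 𝓜(ℂ, B)}
    (h : ∀ i, X * toMult B (e i) = Y * toMult B (e i)) : X = Y := by
  apply star_injective
  refine he.mult_ext fun i => ?_
  have := congrArg star (h i)
  rwa [star_mul, star_mul, ← map_star, he.star_eq] at this

/-- A family of partial isometries with pairwise orthogonal initial and pairwise orthogonal final
projections, only finitely many of which do not annihilate a given `e i` from the left or from the
right. -/
structure IsMultFamily (e v : I → B) : Prop where
  partialIsometry : ∀ i, v i * star (v i) * v i = v i
  star_mul_eq_zero : ∀ i j, i ≠ j → star (v i) * v j = 0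
  mul_star_eq_zero : ∀ i j, i ≠ j → v i * star (v j) = 0
  finite_left : ∀ j, {i | v i * e j ≠ 0}.Finite
  finite_right : ∀ j, {i | e j * v i ≠ 0}.Finite

namespace IsMultFamily

variable {e v : I → B}

theorem adjoint (he : IsGeneratingFamily e) (hv : IsMultFamily e v) :
    IsMultFamily e fun i => star (v i) where
  partialIsometry i := by
    have := congrArg star (hv.partialIsometry i)
    simpa [mul_assoc] using this
  star_mul_eq_zero i j h := by rw [star_star]; exact hv.mul_star_eq_zero i j h
  mul_star_eq_zero i j h := by rw [star_star]; exact hv.star_mul_eq_zero i j h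
  finite_left j := by
    refine (hv.finite_right j).subset fun i hi h => hi ?_
    rw [← he.star_eq, ← star_mul, h, star_zero]
  finite_right j := by
    refine (hv.finite_left j).subset fun i hi h => hi ?_
    rw [← he.star_eq, ← star_mul, h, star_zero]

/-- Finite partial sums are partial isometries. -/
theorem norm_sum_le (hv : IsMultFamily e v) (s : Finset I) : ‖∑ i ∈ s, v i‖ ≤ 1 := by
  classical
  refine norm_le_one_of_partialIsometry ?_
  rw [star_sum, Finset.sum_mul_sum, Finset.sum_mul]
  refine Finset.sum_congr rfl fun i hi => ?_
  rw [Finset.sum_eq_single i (fun j _ hj => hv.mul_star_eq_zero i j hj.symm) fun h => absurd hi h,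
    Finset.mul_sum, Finset.sum_eq_single i (fun j _ hj => by
      rw [mul_assoc, hv.star_mul_eq_zero i j hj.symm, mul_zero]) fun h => absurd hi h]
  exact hv.partialIsometry i

/-- The set of all `b` for which `∑ v i * b` converges is a right ideal, closed since the partial sums
`∑ v i` are bounded, and contains the generating family. -/
theorem summable (he : IsGeneratingFamily e) (hv : IsMultFamily e v) (b : B) :
    Summable fun i => v i * b := by
  let J : Submodule ℂ B :=
    { carrier := {b | Summable fun i => v i * b}
      add_mem' := fun {a b} ha hb => by
        simp only [Set.mem_ofPred_eq, mul_add] at *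
        exact ha.add hb
      zero_mem' := by simp only [Set.mem_ofPred_eq, mul_zero]; exact summable_zero
      smul_mem' := fun c b hb => by
        simp only [Set.mem_ofPred_eq, mul_smul_comm] at *
        exact hb.const_smul c }
  refine he.mem J ?_ (fun b hb c => ?_) (fun j => ?_) b
  · refine isClosed_of_closure_subset fun b hb => ?_
    refine summable_iff_vanishing_norm.2 fun ε hε => ?_
    obtain ⟨b', hb', hd⟩ := Metric.mem_closure_iff.1 hb (ε / 2) (half_pos hε)
    obtain ⟨s, hs⟩ := summable_iff_vanishing_norm.1
      (show Summable fun i => v i * b' from hb') (ε / 2) (half_pos hε)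
    refine ⟨s, fun t ht => ?_⟩
    have h1 : ∑ i ∈ t, v i * b = ∑ i ∈ t, v i * b' + (∑ i ∈ t, v i) * (b - b') := by
      rw [mul_sub, Finset.sum_mul, Finset.sum_mul]; abel
    have h2 : ‖(∑ i ∈ t, v i) * (b - b')‖ < ε / 2 :=
      ((norm_mul_le _ _).trans (mul_le_of_le_one_left (norm_nonneg _) (hv.norm_sum_le t))).trans_lt
        (by rwa [← dist_eq_norm])
    calc ‖∑ i ∈ t, v i * b‖ ≤ _ := by rw [h1]; exact norm_add_le _ _
      _ < ε / 2 + ε / 2 := add_lt_add (hs t ht) h2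
      _ = ε := add_halves ε
  · have hb' : Summable fun i => v i * b := hb
    change Summable fun i => v i * (b * c)
    simpa only [mul_assoc] using hb'.mul_right c
  · exact summable_of_hasFiniteSupport (hv.finite_left j)

theorem summable_right (he : IsGeneratingFamily e) (hv : IsMultFamily e v) (b : B) :
    Summable fun i => b * v i := by
  have := ((hv.adjoint he).summable he (star b)).star
  simpa using this

theorem norm_tsum_le (he : IsGeneratingFamily e) (hv : IsMultFamily e v) (b : B) :
    ‖∑' i, v i * b‖ ≤ 1 * ‖b‖ := by
  refine le_of_tendsto' (hv.summable he b).hasSum.norm fun s => ?_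
  rw [← Finset.sum_mul]
  exact (norm_mul_le _ _).trans (mul_le_mul_of_nonneg_right (hv.norm_sum_le s) (norm_nonneg _))

theorem norm_tsum_right_le (he : IsGeneratingFamily e) (hv : IsMultFamily e v) (b : B) :
    ‖∑' i, b * v i‖ ≤ 1 * ‖b‖ := by
  refine le_of_tendsto' (hv.summable_right he b).hasSum.norm fun s => ?_
  rw [← Finset.mul_sum, mul_comm 1]
  exact (norm_mul_le _ _).trans (mul_le_mul_of_nonneg_left (hv.norm_sum_le s) (norm_nonneg _))

/-- The strict sum `∑ v i` as a multiplier of `B`. -/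
noncomputable def sum (he : IsGeneratingFamily e) (hv : IsMultFamily e v) : 𝓜(ℂ, B) where
  fst := LinearMap.mkContinuous
    { toFun := fun b => ∑' i, v i * b
      map_add' := fun a b => by
        simp only [mul_add]
        exact (hv.summable he a).tsum_add (hv.summable he b)
      map_smul' := fun c b => by
        simp only [mul_smul_comm, RingHom.id_apply]
        exact (hv.summable he b).tsum_const_smul c } 1 (hv.norm_tsum_le he)
  snd := LinearMap.mkContinuous
    { toFun := fun b => ∑' i, b * v i
      map_add' := fun a b => by
        simp only [add_mul]
        exact (hv.summable_right he a).tsum_add (hv.summable_right he b)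
      map_smul' := fun c b => by
        simp only [smul_mul_assoc, RingHom.id_apply]
        exact (hv.summable_right he b).tsum_const_smul c } 1 (hv.norm_tsum_right_le he)
  central x y := by
    change (∑' i, x * v i) * y = x * ∑' i, v i * y
    rw [← (hv.summable_right he x).tsum_mul_right, ← (hv.summable he y).tsum_mul_left]
    simp only [mul_assoc]

theorem toMult_mul_sum (he : IsGeneratingFamily e) (hv : IsMultFamily e v) (b : B) :
    toMult B b * hv.sum he = toMult B (∑' i, b * v i) := by
  refine DoubleCentralizer.ext _ _ _ _ (Prod.ext (ContinuousLinearMap.ext fun y => ?_)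
    (ContinuousLinearMap.ext fun y => ?_))
  · exact ((hv.sum he).central b y).symm
  · change (∑' i, (y * b) * v i) = y * ∑' i, b * v i
    rw [← (hv.summable_right he b).tsum_mul_left]
    simp only [mul_assoc]

end IsMultFamily

end Multiplier

/-! ### Composition in the semi-direct product -/

namespace CatAction

section SemiDirect

variable {G : Type u₁} [Groupoid.{v₁} G] {H : Type u₂} [Category.{v₂} H] {α : CatAction G H}

/-- The unit `α_g(u)` of `H`, for a unit `u` with `φ(u) = s(g)`. -/
def actUnit (α : CatAction G H) (g : Mor G) (u : H) (hu : g.left = α.φ u) : H :=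
  (α.act g (Mor.unit u) ⟨hu, rfl⟩).left

theorem act_mor_unit {g : Mor G} {u : H} (hd : α.Dom g (Mor.unit u)) :
    α.act g (Mor.unit u) hd = Mor.unit (α.actUnit g u hd.1) :=
  α.act_left g (Mor.unit u) hd hd

theorem act_right_eq {g : Mor G} {h : Mor H} (hd : α.Dom g h) :
    (α.act g h hd).right = α.actUnit g h.right hd.unit_right.1 := by
  apply Mor.unit_injective
  rw [← act_mor_unit hd.unit_right, α.act_right g h hd hd.unit_right]

theorem actUnit_inv_actUnit {g : Mor G} {u : H} (hu : g.left = α.φ u)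
    (hu' : g.inv.left = α.φ (α.actUnit g u hu)) :
    α.actUnit g.inv (α.actUnit g u hu) hu' = u := by
  apply Mor.unit_injective
  have hd : α.Dom g (Mor.unit u) := ⟨hu, rfl⟩
  have hd' : α.Dom g.inv (Mor.unit (α.actUnit g u hu)) := ⟨hu', rfl⟩
  rw [← act_mor_unit hd', ← act_inv_act hd (dom_act hd rfl)]
  exact act_congr rfl (act_mor_unit hd).symm _ _

theorem actUnit_actUnit_inv {g : Mor G} {u : H} (hu : g.inv.left = α.φ u)
    (hu' : g.left = α.φ (α.actUnit g.inv u hu)) :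
    α.actUnit g (α.actUnit g.inv u hu) hu' = u := by
  apply Mor.unit_injective
  have hd : α.Dom g.inv (Mor.unit u) := ⟨hu, rfl⟩
  have hd' : α.Dom g (Mor.unit (α.actUnit g.inv u hu)) := ⟨hu', rfl⟩
  rw [← act_mor_unit hd', ← act_act_inv hd (dom_act hd rfl)]
  exact act_congr rfl (act_mor_unit hd).symm _ _

theorem actUnit_congr {g : Mor G} {u u' : H} (h : u = u') (hu : g.left = α.φ u)
    (hu' : g.left = α.φ u') : α.actUnit g u hu = α.actUnit g u' hu' := by subst h; rfl

namespace SemiPair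

theorem toMor_hom (m : Mor α.SemiProd) : m.hom.1.toMor = m := by
  obtain ⟨⟨a⟩, ⟨b⟩, ⟨p, h1, h2⟩⟩ := m
  dsimp at h1 h2
  subst h1 h2
  rfl

theorem comp_hom (m n : Mor α.SemiProd) (h : m.left = n.right) :
    (Mor.comp m n h).hom.1 = mul m.hom.1 n.hom.1
      (m.hom.2.1.trans ((congrArg SemiProd.obj h).trans n.hom.2.2.symm)) := by
  obtain ⟨a, b, f⟩ := m
  obtain ⟨c, d, k⟩ := n
  obtain rfl : a = d := h
  simp only [Mor.comp, eqToHom_refl, Category.id_comp]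
  rfl

theorem toMor_mul (p q : α.SemiPair) (e : p.src = q.tgt) :
    Mor.comp p.toMor q.toMor (show p.toMor.left = q.toMor.right from congrArg SemiProd.mk e) =
      (mul p q e).toMor := by
  rw [← toMor_hom (Mor.comp p.toMor q.toMor _), comp_hom]
  rfl

theorem toMor_one (u : H) : (one u : α.SemiPair).toMor = Mor.unit ⟨u⟩ :=
  toMor_hom (Mor.unit (⟨u⟩ : α.SemiProd))

/-- The generator `S_{(h, g)}` of `C*(H ×_α G)`. -/
noncomputable abbrev S (p : α.SemiPair) : CatCStar α.SemiProd := CatCStar.S p.toMor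

theorem S_mul_S (p q : α.SemiPair) (e : p.src = q.tgt) : p.S * q.S = (mul p q e).S := by
  rw [S, S, CatCStar.isCatRep_S.mul_of_comp _ _
    (show p.toMor.left = q.toMor.right from congrArg SemiProd.mk e), toMor_mul]

theorem S_mul_S_of_ne (p q : α.SemiPair) (e : p.src ≠ q.tgt) : p.S * q.S = 0 :=
  CatCStar.isCatRep_S.mul_of_not_comp _ _ fun h => e (congrArg SemiProd.obj h)

/-- The pair `(u, g)` for a unit `u` with `φ(u) = t(g)`. -/
abbrev unitPair (g : Mor G) (u : H) (hu : g.right = α.φ u) : α.SemiPair := ⟨Mor.unit u, g, hu, hu⟩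

/-- The pair `(h, g k)`. -/
def compRight (p : α.SemiPair) (k : Mor G) (hk : p.g.left = k.right) : α.SemiPair :=
  ⟨p.h, Mor.comp p.g k hk, p.φ_left, p.φ_right⟩

theorem mul_unitPair (p : α.SemiPair) (k : Mor G) (u : H) (hu : k.right = α.φ u)
    (e : p.src = (unitPair k u hu : α.SemiPair).tgt) :
    mul p (unitPair k u hu) e = p.compRight k (g_comp p _ e) := by
  refine SemiPair.ext ?_ rfl
  have h1 := h_comp p _ e
  have hd := dom_comp p _ e
  have hu : α.act p.g (unitPair k u hu : α.SemiPair).h hd = Mor.unit p.h.left := by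
    rw [h1]
    exact α.act_right _ _ hd hd
  refine Eq.trans ?_ (Mor.comp_unit p.h rfl)
  change Mor.comp p.h (α.act p.g _ hd) h1 = _
  congr 1

theorem toMor_comp_unitPair (p : α.SemiPair) (k : Mor G) (u : H) (hu : k.right = α.φ u)
    (e : p.src = u) (hk : p.g.left = k.right)
    (h : p.toMor.left = (unitPair k u hu : α.SemiPair).toMor.right) :
    Mor.comp p.toMor (unitPair k u hu : α.SemiPair).toMor h = (p.compRight k hk).toMor :=
  (toMor_mul p (unitPair k u hu) e).trans (congrArg toMor (mul_unitPair p k u hu e))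

theorem compRight_unitPair (g k : Mor G) (u : H) (hu : g.right = α.φ u) (hk : g.left = k.right) :
    (unitPair g u hu : α.SemiPair).compRight k hk = unitPair (Mor.comp g k hk) u hu := rfl

theorem unitPair_eq_one {g : Mor G} {u : H} (hu : g.right = α.φ u) (hg : g = Mor.unit g.right) :
    unitPair g u hu = (one u : α.SemiPair) := by
  refine SemiPair.ext rfl (hg.trans ?_)
  rw [hu]; rfl

theorem src_unitPair_inv {g : Mor G} {u w : H} (hu : g.right = α.φ u) (hw : g.left = α.φ w)
    (h : (unitPair g u hu : α.SemiPair).src = w) :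
    (unitPair g.inv w hw : α.SemiPair).src = u := by
  subst h
  have hd : α.Dom g.inv (Mor.unit u) := ⟨hu, rfl⟩
  have hd' : α.Dom g (Mor.unit (α.actUnit g.inv u hu)) := ⟨hw, rfl⟩
  have := actUnit_actUnit_inv hu hw
  refine Eq.trans ?_ this
  change (α.act g.inv.inv _ _).left = (α.act g _ _).left
  exact congrArg _ (act_congr (Mor.inv_inv g) rfl _ _)

theorem unitPair_src_injective {g : Mor G} {u u' : H} (hu : g.right = α.φ u)
    (hu' : g.right = α.φ u')
    (h : (unitPair g u hu : α.SemiPair).src = (unitPair g u' hu' : α.SemiPair).src) : u = u' := by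
  have hw : g.left = α.φ (unitPair g u hu : α.SemiPair).src := (φ_src (unitPair g u hu)).symm
  rw [← src_unitPair_inv hu hw rfl, src_unitPair_inv hu' hw h.symm]

/-- `(u, g)` is invertible in `H ×_α G`, with inverse `(α_{g⁻¹}(u), g⁻¹)`. -/
theorem star_S_unitPair (g : Mor G) (u w : H) (hu : g.right = α.φ u) (hw : g.left = α.φ w)
    (h : (unitPair g u hu : α.SemiPair).src = w) :
    star (unitPair g u hu : α.SemiPair).S = (unitPair g.inv w hw : α.SemiPair).S := by
  have h' := src_unitPair_inv hu hw h
  refine IsCatRep.star_of_inverse CatCStar.isCatRep_S (congrArg SemiProd.mk h)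
    (congrArg SemiProd.mk h') ?_ ?_
  · refine (toMor_comp_unitPair _ _ _ hw h rfl _).trans ?_
    rw [compRight_unitPair, unitPair_eq_one _ (Mor.comp_inv g rfl), toMor_one]
    rfl
  · refine (toMor_comp_unitPair _ _ _ hu h' rfl _).trans ?_
    rw [compRight_unitPair, unitPair_eq_one _ (Mor.inv_comp g rfl), toMor_one]
    rfl

theorem S_mul_S_unitPair (p : α.SemiPair) (k : Mor G) (u : H) (hu : k.right = α.φ u)
    (e : p.src = u) (hk : p.g.left = k.right) :
    p.S * (unitPair k u hu : α.SemiPair).S = (p.compRight k hk).S := by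
  rw [S_mul_S _ _ (show p.src = (unitPair k u hu : α.SemiPair).tgt from e), mul_unitPair]

theorem S_mul_S_one (p : α.SemiPair) {u : H} (e : p.src = u) :
    p.S * (one u : α.SemiPair).S = p.S := by
  rw [S_mul_S _ _ (show p.src = (one u : α.SemiPair).tgt from e), mul_one]

theorem S_one_mul_S (p : α.SemiPair) {u : H} (e : u = p.tgt) :
    (one u : α.SemiPair).S * p.S = p.S := by
  rw [S_mul_S _ _ ((src_one u).trans e), one_mul]

end SemiPair

/-! ### The multipliers implementing the action -/

section Mult

open Classical in
variable (α) in
/-- The partial isometries `S_{(u, g)}`, where `u` is a unit with `φ(u) = t(g)`, extended by `0` to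
all units `u`. -/
noncomputable def unitS (g : Mor G) (u : H) : CatCStar α.SemiProd :=
  if hu : g.right = α.φ u then (SemiPair.unitPair g u hu : α.SemiPair).S else 0

theorem unitS_of_eq {g : Mor G} {u : H} (hu : g.right = α.φ u) :
    α.unitS g u = (SemiPair.unitPair g u hu : α.SemiPair).S := dif_pos hu

theorem unitS_of_ne {g : Mor G} {u : H} (hu : g.right ≠ α.φ u) : α.unitS g u = 0 := dif_neg hu

variable (α) in
/-- The projection `S_u` of a unit `u`. -/
noncomputable def oneS (u : H) : CatCStar α.SemiProd := (SemiPair.one u : α.SemiPair).S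

theorem isGeneratingFamily_oneS : IsGeneratingFamily α.oneS where
  star_eq u := by
    rw [oneS, SemiPair.S, SemiPair.toMor_one]; exact CatCStar.isCatRep_S.star_unit _
  mem J hJ hmul he := CatCStar.mem_of_closed_rightIdeal J hJ hmul fun ⟨u⟩ => by
    rw [← SemiPair.toMor_one]; exact he u

theorem oneS_mul_unitS (g : Mor G) (u : H) : α.oneS u * α.unitS g u = α.unitS g u := by
  by_cases hu : g.right = α.φ u
  · rw [unitS_of_eq hu]; exact SemiPair.S_one_mul_S _ rfl
  · rw [unitS_of_ne hu, mul_zero]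

theorem oneS_mul_S_of_ne {w : H} {p : α.SemiPair} (h : w ≠ p.tgt) : α.oneS w * p.S = 0 :=
  SemiPair.S_mul_S_of_ne _ _ fun e => h ((SemiPair.src_one w).symm.trans e)

theorem oneS_mul_unitS_of_ne (g : Mor G) {u w : H} (h : w ≠ u) :
    α.oneS w * α.unitS g u = 0 := by
  by_cases hu : g.right = α.φ u
  · rw [unitS_of_eq hu]; exact oneS_mul_S_of_ne h
  · rw [unitS_of_ne hu, mul_zero]

theorem isMultFamily_unitS (g : Mor G) : IsMultFamily α.oneS (α.unitS g) where
  partialIsometry u := by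
    by_cases hu : g.right = α.φ u
    · rw [unitS_of_eq hu]; exact CatCStar.isCatRep_S.partialIsometry _
    · simp [unitS_of_ne hu]
  star_mul_eq_zero u w h := by
    by_cases hu : g.right = α.φ u
    · by_cases hw : g.right = α.φ w
      · rw [unitS_of_eq hu, unitS_of_eq hw]
        exact CatCStar.isCatRep_S.star_mul_of_ne fun e => h (congrArg SemiProd.obj e)
      · rw [unitS_of_ne hw, mul_zero]
    · rw [unitS_of_ne hu, star_zero, zero_mul]
  mul_star_eq_zero u w h := by
    by_cases hu : g.right = α.φ u
    · by_cases hw : g.right = α.φ w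
      · rw [unitS_of_eq hu, unitS_of_eq hw]
        refine CatCStar.isCatRep_S.mul_star_of_ne fun e => h ?_
        exact SemiPair.unitPair_src_injective hu hw (congrArg SemiProd.obj e)
      · rw [unitS_of_ne hw, star_zero, mul_zero]
    · rw [unitS_of_ne hu, zero_mul]
  finite_left w := by
    refine Set.Subsingleton.finite fun u hu u' hu' => ?_
    have key : ∀ u, α.unitS g u * α.oneS w ≠ 0 →
        ∃ hu : g.right = α.φ u, (SemiPair.unitPair g u hu : α.SemiPair).src = w := by
      intro u h
      by_cases hu : g.right = α.φ u
      · refine ⟨hu, ?_⟩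
        by_contra hne
        rw [unitS_of_eq hu] at h
        exact h (SemiPair.S_mul_S_of_ne _ _ hne)
      · rw [unitS_of_ne hu, zero_mul] at h
        exact absurd rfl h
    obtain ⟨h1, h2⟩ := key u hu
    obtain ⟨h3, h4⟩ := key u' hu'
    exact SemiPair.unitPair_src_injective h1 h3 (h2.trans h4.symm)
  finite_right w := by
    refine (Set.finite_singleton w).subset fun u hu => ?_
    by_contra h
    exact hu (oneS_mul_unitS_of_ne g fun e => h e.symm)

variable (α) in
/-- The multiplier `V_g = ∑_u S_{(u, g)}` of `C*(H ×_α G)`, the sum being over the units `u` with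
`φ(u) = t(g)`. -/
noncomputable def V (g : Mor G) : 𝓜(ℂ, CatCStar α.SemiProd) :=
  (isMultFamily_unitS g).sum isGeneratingFamily_oneS

/-- Of the defining sum, multiplication by the unit `w` leaves the term at `w`. -/
theorem oneS_mul_V (g : Mor G) (w : H) :
    toMult _ (α.oneS w) * α.V g = toMult _ (α.unitS g w) := by
  rw [V, IsMultFamily.toMult_mul_sum, tsum_eq_single w fun u hu => oneS_mul_unitS_of_ne g hu.symm,
    oneS_mul_unitS]

theorem S_mul_V_eq (p : α.SemiPair) (k : Mor G) :
    toMult _ p.S * α.V k = toMult _ (p.S * α.unitS k p.src) := by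
  rw [← SemiPair.S_mul_S_one p rfl, map_mul, mul_assoc]
  erw [oneS_mul_V k p.src]
  rw [← map_mul, SemiPair.S_mul_S_one p rfl]

theorem S_mul_V (p : α.SemiPair) (k : Mor G) (hk : p.g.left = k.right) :
    toMult _ p.S * α.V k = toMult _ (p.compRight k hk).S := by
  rw [S_mul_V_eq, unitS_of_eq (hk.symm.trans p.φ_src.symm), SemiPair.S_mul_S_unitPair _ _ _ _ rfl hk]

theorem S_mul_V_of_ne (p : α.SemiPair) (k : Mor G) (hk : p.g.left ≠ k.right) :
    toMult _ p.S * α.V k = 0 := by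
  rw [S_mul_V_eq, unitS_of_ne fun h => hk (p.φ_src.symm.trans h.symm), mul_zero, map_zero]

theorem V_mul_V (g k : Mor G) (h : g.left = k.right) : α.V g * α.V k = α.V (Mor.comp g k h) := by
  refine isGeneratingFamily_oneS.mult_ext fun w => ?_
  rw [← mul_assoc, oneS_mul_V, oneS_mul_V]
  by_cases hw : g.right = α.φ w
  · rw [unitS_of_eq hw, S_mul_V _ _ h, unitS_of_eq (g := Mor.comp g k h) hw,
      SemiPair.compRight_unitPair]
  · rw [unitS_of_ne hw, unitS_of_ne (g := Mor.comp g k h) hw, map_zero, zero_mul]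

theorem V_mul_V_of_ne (g k : Mor G) (h : g.left ≠ k.right) : α.V g * α.V k = 0 := by
  refine isGeneratingFamily_oneS.mult_ext fun w => ?_
  rw [← mul_assoc, oneS_mul_V, mul_zero]
  by_cases hw : g.right = α.φ w
  · rw [unitS_of_eq hw, S_mul_V_of_ne _ _ h]
  · rw [unitS_of_ne hw, map_zero, zero_mul]

/-- The matrix coefficients of `V_g` and `V_{g⁻¹}` with respect to the units are adjoint to each
other. -/
theorem star_unitS_mul_oneS (g : Mor G) (u w : H) :
    star (α.unitS g u * α.oneS w) = α.unitS g.inv w * α.oneS u := by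
  by_cases h : ∃ hu : g.right = α.φ u, (SemiPair.unitPair g u hu : α.SemiPair).src = w
  · obtain ⟨hu, h⟩ := h
    have hw : g.left = α.φ w := by rw [← h, SemiPair.φ_src]
    rw [unitS_of_eq hu, unitS_of_eq (g := g.inv) hw, oneS, oneS, SemiPair.S_mul_S_one _ h,
      SemiPair.S_mul_S_one _ (SemiPair.src_unitPair_inv hu hw h),
      SemiPair.star_S_unitPair g u w hu hw h]
  · have h1 : α.unitS g u * α.oneS w = 0 := by
      by_cases hu : g.right = α.φ u
      · rw [unitS_of_eq hu]; exact SemiPair.S_mul_S_of_ne _ _ fun e => h ⟨hu, e⟩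
      · rw [unitS_of_ne hu, zero_mul]
    rw [h1, star_zero]
    by_cases hw : g.inv.right = α.φ w
    · rw [unitS_of_eq hw]
      refine (SemiPair.S_mul_S_of_ne _ _ fun e => h ?_).symm
      have e' : (SemiPair.unitPair g.inv w hw : α.SemiPair).src = u := e
      have hu : g.inv.left = α.φ u := by rw [← e', SemiPair.φ_src]
      refine ⟨hu, ?_⟩
      have := SemiPair.src_unitPair_inv hw hu e'
      rw [← this]
      congr 2
      exact (Mor.inv_inv g).symm
    · rw [unitS_of_ne hw, zero_mul]

theorem star_V (g : Mor G) : star (α.V g) = α.V g.inv := by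
  refine isGeneratingFamily_oneS.mult_ext fun w =>
    isGeneratingFamily_oneS.mult_ext_right fun u => ?_
  rw [oneS_mul_V, ← map_mul, ← star_unitS_mul_oneS, map_star, map_mul, ← oneS_mul_V, star_mul,
    star_mul, ← map_star, ← map_star, isGeneratingFamily_oneS.star_eq,
    isGeneratingFamily_oneS.star_eq, mul_assoc]

end Mult

end SemiDirect

end CatAction

namespace CatAction

/-! ### The covariant pair in the multiplier algebra -/

section Covariant

variable {G : Type u₁} [Groupoid.{v₁} G] {H : Type u₂} [Category.{v₂} H] {α : CatAction G H}

/-- The pair `(h, g)` for `h ∈ H_r` with `φ(t(h)) = t(g)`. -/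
abbrev pairOf (h : Mor α.Reg) (g : Mor G) (hg : g.right = α.φ h.right.obj) : α.SemiPair :=
  ⟨ofReg h, g, hg.trans (α.restrict_isRegular h).symm, hg⟩

/-- The pair `(h, φ(t(h)))`. -/
abbrev embPair (h : Mor α.Reg) : α.SemiPair := pairOf h (Mor.unit (α.φ h.right.obj)) rfl

theorem src_of_unit (p : α.SemiPair) (x : G) (hx : p.g = Mor.unit x) : p.src = p.h.left := by
  have h2 : α.Dom (Mor.unit x) (Mor.unit p.h.left) := by
    rw [← hx]
    exact ⟨by rw [← p.φ_left, hx], rfl⟩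
  have e : p.g.inv = Mor.unit x := by rw [hx]; simp [Mor.inv, Mor.unit]
  have : α.act p.g.inv (Mor.unit p.h.left) p.dom_inv.unit_left = Mor.unit p.h.left :=
    (act_congr e rfl _ h2).trans (act_unit' h2)
  have h3 := congrArg (fun m : Mor H => m.left) this
  exact h3

theorem src_embPair (h : Mor α.Reg) : (embPair h).src = h.left.obj :=
  src_of_unit (embPair h) _ rfl

theorem mul_hr (p q : α.SemiPair) (e : p.src = q.tgt)
    (hd : α.restrict.Dom p.g q.hr) (hc : p.hr.left = (α.restrict.act p.g q.hr hd).right) :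
    (SemiPair.mul p q e).hr = Mor.comp p.hr (α.restrict.act p.g q.hr hd) hc :=
  ofReg_injective (ofReg_comp α p.hr (α.restrict.act p.g q.hr hd) hc).symm

theorem embPair_mul (h k : Mor α.Reg) (e : h.left = k.right)
    (e' : (embPair h).src = (embPair k).tgt) :
    SemiPair.mul (embPair h) (embPair k) e' = embPair (Mor.comp h k e) := by
  have hd : α.restrict.Dom (Mor.unit (α.φ h.right.obj)) k :=
    SemiPair.dom_comp (embPair h) (embPair k) e'
  have h1 : α.restrict.act (Mor.unit (α.φ h.right.obj)) k hd = k := act_unit' hd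
  refine SemiPair.ext ?_ ?_
  · have := mul_hr (embPair h) (embPair k) e' hd (by exact e.trans (congrArg _ h1.symm))
    refine congrArg ofReg (this.trans ?_)
    change Mor.comp h (α.restrict.act (Mor.unit (α.φ h.right.obj)) k hd) _ = _
    congr 1
  · have hk : α.φ h.right.obj = (embPair k).g.right :=
      (α.restrict_isRegular h).symm.trans (congrArg (fun x : α.Reg => α.φ x.obj) e)
    refine (Mor.unit_comp (embPair k).g hk).trans ?_
    exact congrArg Mor.unit hk.symm

theorem src_unitPair_act {g : Mor G} {h : Mor H} (hd : α.Dom g h)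
    (hφ : g.right = α.φ (α.act g h hd).right) :
    (SemiPair.unitPair g (α.act g h hd).right hφ : α.SemiPair).src = h.right := by
  have e := act_right_eq hd
  have hφ' : g.right = α.φ (α.actUnit g h.right hd.1) := e ▸ hφ
  refine Eq.trans ?_ (actUnit_inv_actUnit hd.1 hφ')
  exact actUnit_congr e hφ hφ'

/-- If `(h, g)` divides `(k, l)`, then `h` divides `k` in `H_r`. -/
theorem divides_hr {p : α.SemiPair} {m : Mor α.SemiProd} (h : Mor.Divides p.toMor m) :
    Mor.Divides p.hr m.hom.1.hr := by
  obtain ⟨k, e, rfl⟩ := h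
  have e' : p.src = k.hom.1.tgt := (congrArg SemiProd.obj e).trans k.hom.2.2.symm
  have hd := SemiPair.dom_comp p k.hom.1 e'
  have hc : p.hr.left = (α.restrict.act p.g k.hom.1.hr hd).right :=
    WideSubcategory.ext (SemiPair.h_comp p k.hom.1 e')
  refine ⟨α.restrict.act p.g k.hom.1.hr hd, hc, ?_⟩
  rw [SemiPair.comp_hom]
  exact (mul_hr p k.hom.1 e' hd hc).symm

/-- If `h` divides `m` in `H_r`, then `(h, g)` divides `(m, t(g))`, the quotient being
`(α_{g⁻¹}(k), g⁻¹)` for `m = h k`. -/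
theorem divides_toMor {p : α.SemiPair} {m : Mor α.Reg} (h : Mor.Divides p.hr m)
    (hm : p.g.right = α.φ m.right.obj) :
    Mor.Divides p.toMor (pairOf m (Mor.unit p.g.right) hm).toMor := by
  obtain ⟨k, e, rfl⟩ := h
  have hk : p.g.right = α.φ k.right.obj := by
    rw [p.φ_left]; exact congrArg (fun x : α.Reg => α.φ x.obj) e
  have hd : α.restrict.Dom p.g.inv k := ⟨hk, (α.restrict_isRegular k).symm⟩
  have hd' := dom_act (g' := p.g) hd rfl
  let q : α.SemiPair := pairOf (α.restrict.act p.g.inv k hd) p.g.inv (φ_act_right hd).symm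
  have e' : p.src = q.tgt := by
    refine Eq.trans ?_ (act_right_eq (h := ofReg k) hd).symm
    exact actUnit_congr (congrArg WideSubcategory.obj e) p.φ_left hk
  refine ⟨q.toMor, congrArg SemiProd.mk e', (SemiPair.toMor_mul p q e').trans (congrArg _ ?_)⟩
  have ha : α.restrict.act p.g q.hr hd' = k := act_act_inv hd hd'
  refine SemiPair.ext ?_ (Mor.comp_inv p.g rfl)
  refine congrArg ofReg ((mul_hr p q e' hd' (by rw [ha]; exact e)).trans ?_)
  congr 1

/-- The representation `h ↦ S_{(h, φ(t(h)))}` of `H_r`. -/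
theorem isCatRep_embPair : IsCatRep fun h : Mor α.Reg => (embPair h).S where
  partialIsometry _ := CatCStar.isCatRep_S.partialIsometry _
  mul_of_comp h k e := by
    have e' : (embPair h).src = (embPair k).tgt :=
      (src_embPair h).trans (congrArg WideSubcategory.obj e)
    rw [SemiPair.S_mul_S _ _ e', embPair_mul h k e]
  mul_of_not_comp h k e := SemiPair.S_mul_S_of_ne _ _ fun e' => e (by
    have := (src_embPair h).symm.trans e'
    exact WideSubcategory.ext this)
  commute_initial _ _ := CatCStar.isCatRep_S.commute_initial _ _
  commute_final _ _ := CatCStar.isCatRep_S.commute_final _ _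
  commute_initial_final _ _ := CatCStar.isCatRep_S.commute_initial_final _ _
  disjoint h k hd := CatCStar.isCatRep_S.disjoint _ _ (by
    rintro ⟨m, hm, hm'⟩
    exact hd ⟨m.hom.1.hr, divides_hr hm, divides_hr hm'⟩)
  initial_mul_final h k e := CatCStar.isCatRep_S.initial_mul_final _ _ (by
    have := (src_embPair h).trans (congrArg WideSubcategory.obj e)
    exact congrArg SemiProd.mk this)

/-- The *-homomorphism `C*(H_r) → M(C*(H ×_α G))` with `S_h ↦ S_{(h, φ(t(h)))}`. -/
noncomputable def π (α : CatAction G H) : CatCStar α.Reg →⋆ₙₐ[ℂ] 𝓜(ℂ, CatCStar α.SemiProd) :=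
  (toMult _).comp (CatCStar.lift _ isCatRep_embPair)

theorem π_S (h : Mor α.Reg) : α.π (CatCStar.S h) = toMult _ (embPair h).S :=
  congrArg (toMult _) (CatCStar.lift_S _ isCatRep_embPair h)

theorem π_S_mul_V (h : Mor α.Reg) (g : Mor G) (hg : g.right = α.φ h.right.obj) :
    α.π (CatCStar.S h) * α.V g = toMult _ (pairOf h g hg).S := by
  rw [π_S, S_mul_V _ _ hg.symm]
  have : (embPair h).compRight g hg.symm = pairOf h g hg :=
    SemiPair.ext rfl (Mor.unit_comp g hg.symm)
  rw [this]

theorem π_S_mul_V_of_ne (h : Mor α.Reg) (g : Mor G) (hg : g.right ≠ α.φ h.right.obj) :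
    α.π (CatCStar.S h) * α.V g = 0 := by
  rw [π_S]; exact S_mul_V_of_ne _ _ hg.symm

theorem V_mul_π_S (h : Mor α.Reg) (g : Mor G) (hd : α.restrict.Dom g h) :
    α.V g * α.π (CatCStar.S h) = α.π (CatCStar.S (α.restrict.act g h hd)) * α.V g := by
  have hφ : g.right = α.φ (α.restrict.act g h hd).right.obj := (φ_act_right hd).symm
  rw [π_S_mul_V _ _ hφ, π_S]
  refine isGeneratingFamily_oneS.mult_ext fun w => ?_
  rw [← mul_assoc, oneS_mul_V, ← map_mul, ← map_mul]
  congr 1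
  by_cases hw : w = (α.restrict.act g h hd).right.obj
  · subst hw
    rw [oneS, SemiPair.S_one_mul_S (pairOf _ g hφ) (u := (α.restrict.act g h hd).right.obj) rfl,
      unitS_of_eq hφ]
    have e : (SemiPair.unitPair g (α.restrict.act g h hd).right.obj hφ : α.SemiPair).src =
        (embPair h).tgt := src_unitPair_act (h := ofReg h) hd hφ
    rw [SemiPair.S_mul_S _ _ e]
    congr 1
    refine SemiPair.ext ?_ (Mor.comp_unit g hd.1)
    exact Mor.unit_comp _ rfl
  · rw [oneS, SemiPair.S_mul_S_of_ne _ _ fun e => hw ((SemiPair.src_one w).symm.trans e)]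
    by_cases hu : g.right = α.φ w
    · rw [unitS_of_eq hu, SemiPair.S_mul_S_of_ne _ _ fun e => hw ?_]
      exact SemiPair.unitPair_src_injective hu hφ
        (e.trans (src_unitPair_act (h := ofReg h) hd hφ).symm)
    · rw [unitS_of_ne hu, zero_mul]

theorem V_mul_π_S_of_not (h : Mor α.Reg) (g : Mor G) (hd : ¬ α.restrict.Dom g h) :
    α.V g * α.π (CatCStar.S h) = 0 := by
  rw [π_S]
  refine isGeneratingFamily_oneS.mult_ext fun w => ?_
  rw [← mul_assoc, oneS_mul_V, ← map_mul, mul_zero]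
  by_cases hu : g.right = α.φ w
  · rw [unitS_of_eq hu, SemiPair.S_mul_S_of_ne _ _ fun e => hd ?_, map_zero]
    refine ⟨?_, (α.restrict_isRegular h).symm⟩
    rw [← SemiPair.φ_src (SemiPair.unitPair g w hu), e]; rfl
  · rw [unitS_of_ne hu, zero_mul, map_zero]

/-- The action of `G` on `C*(H_r)`. -/
noncomputable abbrev β (α : CatAction G H) : QuasiAction G (CatCStar α.Reg) :=
  quasiAction α.restrict_isRegular

theorem V_mul_π_S_eq_hom (h : Mor α.Reg) (g : Mor G) :
    α.V g * α.π (CatCStar.S h) = α.π (α.β.hom g (CatCStar.S h)) * α.V g := by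
  by_cases hd : α.restrict.Dom g h
  · rw [V_mul_π_S h g hd]
    have : α.β.hom g (CatCStar.S h) = CatCStar.S (α.restrict.act g h hd) :=
      indHom_S_of_dom α.restrict_isRegular hd
    rw [this]
  · have : α.β.hom g (CatCStar.S h) = 0 := indHom_S_of_not α.restrict_isRegular hd
    rw [V_mul_π_S_of_not h g hd, this, map_zero, zero_mul]

/-- The adjoint of the relation for `g⁻¹` is the relation for `g` with `S_h*` in place of `S_h`. -/
theorem V_mul_π_star_S (h : Mor α.Reg) (g : Mor G) :
    α.V g * α.π (star (CatCStar.S h)) = α.π (α.β.hom g (star (CatCStar.S h))) * α.V g := by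
  rw [map_star, map_star, map_star]
  apply star_injective
  rw [star_mul, star_star, star_V, star_mul, star_star, star_V]
  by_cases hd : α.restrict.Dom g h
  · have : α.β.hom g (CatCStar.S h) = CatCStar.S (α.restrict.act g h hd) :=
      indHom_S_of_dom α.restrict_isRegular hd
    rw [this, V_mul_π_S _ _ (dom_act hd rfl), act_inv_act]
  · have : α.β.hom g (CatCStar.S h) = 0 := indHom_S_of_not α.restrict_isRegular hd
    rw [this, map_zero, mul_zero]
    exact π_S_mul_V_of_ne h g.inv fun e => hd ⟨e, (α.restrict_isRegular h).symm⟩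

/-- The covariance relation. It holds for generators and their adjoints, and the set of all `a` such
that it holds for `a` and `a*` is a closed *-subalgebra. -/
theorem V_mul_π (g : Mor G) (a : CatCStar α.Reg) :
    α.V g * α.π a = α.π (α.β.hom g a) * α.V g := by
  let K : NonUnitalStarSubalgebra ℂ (CatCStar α.Reg) :=
    { carrier := {a | α.V g * α.π a = α.π (α.β.hom g a) * α.V g ∧
        α.V g * α.π (star a) = α.π (α.β.hom g (star a)) * α.V g}
      add_mem' := fun {a b} ha hb => by
        simp only [Set.mem_ofPred_eq, star_add, map_add, mul_add, add_mul] at *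
        exact ⟨congrArg₂ _ ha.1 hb.1, congrArg₂ _ ha.2 hb.2⟩
      zero_mem' := by simp
      mul_mem' := fun {a b} ha hb => by
        simp only [Set.mem_ofPred_eq, star_mul, map_mul] at *
        refine ⟨?_, ?_⟩
        · rw [← mul_assoc, ha.1, mul_assoc, hb.1, mul_assoc]
        · rw [← mul_assoc, hb.2, mul_assoc, ha.2, mul_assoc]
      smul_mem' := fun c a ha => by
        simp only [Set.mem_ofPred_eq, star_smul, map_smul, mul_smul_comm, smul_mul_assoc] at *
        exact ⟨congrArg _ ha.1, congrArg _ ha.2⟩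
      star_mem' := fun {a} ha => by
        simp only [Set.mem_ofPred_eq, star_star] at *
        exact ha.symm }
  have hπ : Continuous α.π := map_continuous α.π
  have hβ : Continuous (α.β.hom g) := map_continuous (α.β.hom g)
  have hK : IsClosed (K : Set (CatCStar α.Reg)) := by
    refine IsClosed.inter (isClosed_eq ?_ ?_) (isClosed_eq ?_ ?_)
    · exact continuous_const.mul hπ
    · exact (hπ.comp hβ).mul continuous_const
    · exact continuous_const.mul (hπ.comp continuous_star)
    · exact (hπ.comp (hβ.comp continuous_star)).mul continuous_const
  exact (CatCStar.mem_of_closed K hK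
    (fun h => ⟨V_mul_π_S_eq_hom h g, V_mul_π_star_S h g⟩) a).1

end Covariant

end CatAction

/-! ### Crossed products by quasi actions -/

namespace QuasiAction

variable {G : Type u₁} [Groupoid.{v₁} G] {A : Type w} [NonUnitalCStarAlgebra A]
  {β : QuasiAction G A}

namespace Alg

theorem mono_congr {s t : Mor G} {a b : A} (h : s = t) (hab : a = b) (ha : a ∈ β.dom s.inv)
    (hb : b ∈ β.dom t.inv) : mono s a ha = mono t b hb := by
  subst h hab; rfl

theorem mono_mul_mono {s t : Mor G} (h : s.left = t.right) {a b : A} (ha : a ∈ β.dom s.inv)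
    (hb : b ∈ β.dom t.inv) (hab : a * β.hom s b ∈ β.dom (Mor.comp s t h).inv) :
    mono s a ha * mono t b hb = mono (Mor.comp s t h) (a * β.hom s b) hab :=
  Subtype.ext ((Conv.mono_mul_mono s a t b).trans (Conv.monoMul_of_comp h a b))

theorem mono_mul_mono_of_ne {s t : Mor G} (h : s.left ≠ t.right) {a b : A} (ha : a ∈ β.dom s.inv)
    (hb : b ∈ β.dom t.inv) : mono s a ha * mono t b hb = 0 :=
  Subtype.ext ((Conv.mono_mul_mono s a t b).trans (Conv.monoMul_of_not h a b))

theorem star_mono {t : Mor G} {a : A} (ha : a ∈ β.dom t.inv) :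
    star (mono t a ha) = mono t.inv (β.hom t.inv (star a)) (β.hom_mem_dom_inv _ _) :=
  Subtype.ext (Conv.adj_mono t a)

@[elab_as_elim]
theorem ind {P : β.Alg → Prop} (f : β.Alg) (zero : P 0) (add : ∀ f g, P f → P g → P (f + g))
    (mono : ∀ t a ha, P (mono t a ha)) : P f := by
  have := β.algSubmodule_induction (P := fun f => ∃ hf : f ∈ β.algSubmodule, P ⟨f, hf⟩)
    ⟨zero_mem _, zero⟩ (fun f g ⟨hf, pf⟩ ⟨hg, pg⟩ => ⟨add_mem hf hg, add _ _ pf pg⟩)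
    (fun t a ha => ⟨β.mono_mem_algSubmodule ha, mono t a ha⟩) f.2
  exact this.2

theorem l1norm_mono {t : Mor G} {a : A} (ha : a ∈ β.dom t.inv) : (mono t a ha).l1norm = ‖a‖ :=
  Finsupp.sum_single_index norm_zero

end Alg

theorem crossedNorm_le_l1norm (f : β.Alg) : β.crossedNorm f ≤ f.l1norm := by
  refine CStarSeminorm.sup_le β.repSeminorms_bounded ?_ ?_
  · exact Finset.sum_nonneg fun _ _ => norm_nonneg _
  · rintro _ ⟨K, _, _, _, σ, hσ, rfl⟩; exact hσ f

theorem _root_.Mor.inv_unit (x : G) : (Mor.unit x).inv = Mor.unit x := by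
  simp [Mor.inv, Mor.unit]

variable (β) in
/-- `β_{t(g)}` maps `A` to `D(β_{g⁻¹})`, the set of coefficients which may stand before `g`. -/
theorem hom_unit_mem (g : Mor G) (a : A) : β.hom (Mor.unit g.right) a ∈ β.dom g.inv := by
  have := β.hom_mem_dom_inv (Mor.unit g.right) a
  rwa [Mor.inv_unit, β.dom_unit g] at this

variable (β) in
/-- The linear map `a ↦ β_{t(g)}(a) g` from `A` to the crossed product, where `β_{t(g)}` projects
`A` onto the admissible coefficients of `g`. -/
noncomputable def term (g : Mor G) : A →ₗ[ℂ] β.CrossedProduct where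
  toFun a := β.toCrossed (Alg.mono g (β.hom (Mor.unit g.right) a) (β.hom_unit_mem g a))
  map_add' a b := by
    rw [← map_add]
    congr 1
    exact Subtype.ext ((congrArg (Conv.mono β g) (map_add _ a b)).trans (Conv.mono_add _ _ _))
  map_smul' c a := by
    rw [RingHom.id_apply, ← map_smul]
    congr 1
    exact Subtype.ext
      ((congrArg (Conv.mono β g) (map_smul _ c a)).trans (Conv.smul_mono _ _ _).symm)

theorem hom_unit_right (t : Mor G) (a : A) :
    β.hom (Mor.unit t.right) (β.hom t a) = β.hom t a := by
  rw [← β.hom_comp _ t rfl, Mor.unit_comp]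

theorem hom_hom_unit_left (t : Mor G) (a : A) {x : G} (hx : t.left = x) :
    β.hom t (β.hom (Mor.unit x) a) = β.hom t a := by
  rw [← β.hom_comp t _ hx, Mor.comp_unit]

theorem term_eq {g : Mor G} {a : A} (ha : a ∈ β.dom g.inv) :
    β.term g a = β.toCrossed (Alg.mono g a ha) :=
  congrArg β.toCrossed (Alg.mono_congr rfl (β.hom_unit _ (by rw [dom_unit]; exact ha)) _ _)

theorem term_congr {g g' : Mor G} {a a' : A} (hg : g = g')
    (ha : β.hom (Mor.unit g.right) a = β.hom (Mor.unit g.right) a') :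
    β.term g a = β.term g' a' := by
  subst hg
  exact congrArg β.toCrossed (Alg.mono_congr rfl ha _ _)

theorem term_mul_term {g k : Mor G} (h : g.left = k.right) (a b : A) :
    β.term g a * β.term k b = β.term (Mor.comp g k h) (a * β.hom g b) := by
  refine (map_mul β.toCrossed _ _).symm.trans (congrArg β.toCrossed ?_)
  have e : β.hom (Mor.unit g.right) a * β.hom g (β.hom (Mor.unit k.right) b) =
      β.hom (Mor.unit g.right) (a * β.hom g b) := by
    rw [map_mul, hom_hom_unit_left _ _ h, hom_unit_right]
  rw [Alg.mono_mul_mono h]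
  · exact Alg.mono_congr rfl e _ _
  · rw [e, dom_inv_comp]
    exact β.hom_unit_mem g _

theorem term_mul_term_of_ne {g k : Mor G} (h : g.left ≠ k.right) (a b : A) :
    β.term g a * β.term k b = 0 := by
  refine (map_mul β.toCrossed _ _).symm.trans ?_
  rw [Alg.mono_mul_mono_of_ne h, map_zero]

theorem star_term (g : Mor G) (a : A) :
    star (β.term g a) = β.term g.inv (β.hom g.inv (star a)) := by
  refine (map_star β.toCrossed _).symm.trans (congrArg β.toCrossed ?_)
  rw [Alg.star_mono]
  refine Alg.mono_congr rfl ?_ _ _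
  rw [← map_star, hom_hom_unit_left _ _ (by rfl)]
  exact (hom_unit_right g.inv _).symm

theorem norm_term_le (g : Mor G) (a : A) : ‖β.term g a‖ ≤ ‖a‖ := by
  refine (CStarSeminorm.norm_incl _ _).trans_le ((crossedNorm_le_l1norm _).trans ?_)
  rw [Alg.l1norm_mono]
  exact NonUnitalStarAlgHom.norm_apply_le _ _

theorem continuous_term (g : Mor G) : Continuous (β.term g) :=
  (LinearMap.mkContinuous (β.term g) 1 fun a => by rw [one_mul]; exact norm_term_le g a).continuous

variable (β) in
/-- The *-homomorphism `a ↦ β_x(a) x` for a unit `x`. -/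
noncomputable def unitHom (x : G) : A →⋆ₙₐ[ℂ] β.CrossedProduct where
  toFun := β.term (Mor.unit x)
  map_smul' := map_smul _
  map_zero' := map_zero _
  map_add' := map_add _
  map_mul' a b := by
    rw [term_mul_term rfl]
    refine term_congr (Mor.comp_unit (Mor.unit x) rfl).symm ?_
    rw [map_mul, map_mul, hom_unit_right]
  map_star' a := by
    rw [star_term]
    rw [Mor.inv_unit]
    exact term_congr rfl (hom_unit_right (Mor.unit x) _).symm

theorem unitHom_apply (x : G) (a : A) : β.unitHom x a = β.term (Mor.unit x) a := rfl

theorem term_mul (g : Mor G) (a b : A) :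
    β.term g (a * b) = β.unitHom g.right a * β.term g b := by
  rw [unitHom_apply, term_mul_term rfl]
  refine term_congr (Mor.unit_comp g rfl).symm ?_
  rw [map_mul, map_mul]
  exact congrArg _ (hom_unit_right (Mor.unit g.right) b).symm

theorem unitHom_mul_of_ne {x y : G} (h : x ≠ y) (a b : A) : β.unitHom x a * β.unitHom y b = 0 :=
  term_mul_term_of_ne h a b

theorem commute_unitHom (x y : G) {a b : A} (h : Commute a b) :
    Commute (β.unitHom x a) (β.unitHom y b) := by
  by_cases e : x = y
  · subst e; exact h.map _
  · rw [commute_iff_eq, unitHom_mul_of_ne e, unitHom_mul_of_ne (Ne.symm e)]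

theorem term_mul_star_term (g : Mor G) (a : A) :
    β.term g a * star (β.term g a) = β.unitHom g.right (a * star a) := by
  rw [star_term, term_mul_term rfl]
  refine term_congr (Mor.comp_inv g rfl) ?_
  rw [← β.hom_comp g g.inv rfl, Mor.comp_inv, map_mul, map_mul]
  exact congrArg _ (hom_unit_right (Mor.unit g.right) _)

theorem star_term_mul_term (g : Mor G) (a : A) :
    star (β.term g a) * β.term g a =
      β.unitHom g.left (star (β.hom g.inv a) * β.hom g.inv a) := by
  rw [star_term, term_mul_term rfl, ← map_star]
  exact term_congr (Mor.inv_comp g rfl) rfl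

/-! ### Covariant pairs -/

/-- A *-homomorphism `π` of `A` and partial isometries `V_g` which implement the quasi action. -/
structure IsCovariant {M : Type*} [CStarAlgebra M] (β : QuasiAction G A) (π : A →⋆ₙₐ[ℂ] M)
    (V : Mor G → M) : Prop where
  mul_of_comp : ∀ s t (h : s.left = t.right), V s * V t = V (Mor.comp s t h)
  mul_of_not_comp : ∀ s t : Mor G, s.left ≠ t.right → V s * V t = 0
  star_eq : ∀ s, star (V s) = V s.inv
  covariant : ∀ s a, V s * π a = π (β.hom s a) * V s

namespace IsCovariant

variable {M : Type*} [CStarAlgebra M] {π : A →⋆ₙₐ[ℂ] M} {V : Mor G → M}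

theorem norm_le (h : IsCovariant β π V) (s : Mor G) : ‖V s‖ ≤ 1 := by
  refine norm_le_one_of_partialIsometry ?_
  rw [h.star_eq, h.mul_of_comp s s.inv rfl, Mor.comp_inv, h.mul_of_comp _ s rfl, Mor.unit_comp]

variable (π V) in
/-- The linear map `∑ a_t t ↦ ∑ π(a_t) V_t`. -/
noncomputable def linear : β.Conv →ₗ[ℂ] M :=
  Finsupp.lsum (M := A) (N := M) ℂ fun t : Mor G =>
    { toFun := fun a => π a * V t
      map_add' := fun a b => by rw [map_add, add_mul]
      map_smul' := fun c a => by rw [map_smul, smul_mul_assoc, RingHom.id_apply] }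

theorem linear_mono (t : Mor G) (a : A) : linear π V (Conv.mono β t a) = π a * V t :=
  Finsupp.lsum_single _ _ _ _

theorem norm_linear_le (h : IsCovariant β π V) (f : β.Alg) : ‖linear π V f.1‖ ≤ f.l1norm := by
  refine (norm_sum_le _ _).trans (Finset.sum_le_sum fun t _ => ?_)
  refine (norm_mul_le _ _).trans ?_
  refine (mul_le_of_le_one_right (norm_nonneg _) (h.norm_le t)).trans ?_
  exact NonUnitalStarAlgHom.norm_apply_le _ _

theorem linear_mul (h : IsCovariant β π V) (f k : β.Conv) :
    linear π V (f * k) = linear π V f * linear π V k := by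
  induction f using Conv.ind with
  | zero => rw [zero_mul, map_zero, zero_mul]
  | add f f' hf hf' => rw [add_mul, map_add, map_add, hf, hf', add_mul]
  | mono t a =>
    induction k using Conv.ind with
    | zero => rw [mul_zero, map_zero, mul_zero]
    | add k k' hk hk' => rw [mul_add, map_add, map_add, hk, hk', mul_add]
    | mono u b =>
      rw [Conv.mono_mul_mono, linear_mono, linear_mono]
      have e : π a * V t * (π b * V u) = π (a * β.hom t b) * (V t * V u) := by
        rw [mul_assoc, ← mul_assoc (V t), h.covariant, map_mul, mul_assoc, mul_assoc]
      rw [e]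
      by_cases hc : t.left = u.right
      · rw [Conv.monoMul_of_comp hc, linear_mono, h.mul_of_comp t u hc]
      · rw [Conv.monoMul_of_not hc, h.mul_of_not_comp t u hc, map_zero, mul_zero]

theorem linear_adj (h : IsCovariant β π V) (f : β.Conv) :
    linear π V (Conv.adj f) = star (linear π V f) := by
  induction f using Conv.ind with
  | zero => rw [map_zero, map_zero, star_zero]
  | add f f' hf hf' => rw [map_add, map_add, map_add, hf, hf', star_add]
  | mono t a =>
    rw [Conv.adj_mono, linear_mono, linear_mono, star_mul, h.star_eq, ← map_star, h.covariant]

/-- The *-homomorphism `∑ a_t t ↦ ∑ π(a_t) V_t` on `A[G]`. -/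
noncomputable def algHom (h : IsCovariant β π V) : β.Alg →⋆ₙₐ[ℂ] M where
  toFun f := linear π V f.1
  map_smul' c f := map_smul (linear π V) c f.1
  map_zero' := map_zero (linear π V)
  map_add' f k := map_add (linear π V) f.1 k.1
  map_mul' f k := h.linear_mul f.1 k.1
  map_star' f := h.linear_adj f.1

end IsCovariant

/-- The norm of the crossed product, defined by means of representations on Hilbert spaces, dominates
every `ℓ¹`-contractive *-homomorphism to a unital C*-algebra. -/
theorem norm_le_crossedNorm {M : Type (max u₁ v₁ w)} [CStarAlgebra M] (σ : β.Alg →⋆ₙₐ[ℂ] M)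
    (hσ : ∀ f, ‖σ f‖ ≤ f.l1norm) (f : β.Alg) : ‖σ f‖ ≤ β.crossedNorm f := by
  obtain ⟨K, _, _, _, ρ, hρ⟩ := exists_rep_norm_le (σ f)
  refine hρ.trans ?_
  refine CStarSeminorm.le_sup β.repSeminorms_bounded
    (p := CStarSeminorm.ofHom (ρ.comp σ)) ⟨K, _, _, _, ρ.comp σ, fun k => ?_, rfl⟩ f
  exact (NonUnitalStarAlgHom.norm_apply_le ρ (σ k)).trans (hσ k)

/-- The integrated form of a covariant pair. -/
noncomputable def IsCovariant.lift {M : Type (max u₁ v₁ w)} [CStarAlgebra M] {π : A →⋆ₙₐ[ℂ] M}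
    {V : Mor G → M} (h : IsCovariant β π V) : β.CrossedProduct →⋆ₙₐ[ℂ] M :=
  CStarSeminorm.lift h.algHom (norm_le_crossedNorm h.algHom h.norm_linear_le)

theorem IsCovariant.lift_mono {M : Type (max u₁ v₁ w)} [CStarAlgebra M] {π : A →⋆ₙₐ[ℂ] M}
    {V : Mor G → M} (h : IsCovariant β π V) {t : Mor G} {a : A} (ha : a ∈ β.dom t.inv) :
    h.lift (β.toCrossed (Alg.mono t a ha)) = π a * V t :=
  (CStarSeminorm.lift_incl h.algHom _ _).trans (IsCovariant.linear_mono (β := β) t a)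

end QuasiAction

/-! ### The isomorphism -/

namespace CatAction

open QuasiAction

variable {G : Type u₁} [Groupoid.{v₁} G] {H : Type u₂} [Category.{v₂} H] {α : CatAction G H}

theorem hom_S (g : Mor G) (h : Mor α.Reg) (hd : α.restrict.Dom g h) :
    α.β.hom g (CatCStar.S h) = CatCStar.S (α.restrict.act g h hd) :=
  indHom_S_of_dom α.restrict_isRegular hd

/-- The element `S_h g` of the crossed product. -/
noncomputable def crossedS (p : α.SemiPair) : α.β.CrossedProduct :=
  α.β.term p.g (CatCStar.S p.hr)

theorem crossedS_eq (p : α.SemiPair) :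
    crossedS p = α.β.toCrossed (QuasiAction.Alg.mono p.g (CatCStar.S p.hr) p.S_hr_mem) :=
  term_eq p.S_hr_mem

theorem dom_inv_hr (p : α.SemiPair) : α.restrict.Dom p.g.inv p.hr := p.dom_inv

theorem crossedS_mul (p q : α.SemiPair) (e : p.src = q.tgt) :
    crossedS p * crossedS q = crossedS (SemiPair.mul p q e) := by
  have hd : α.restrict.Dom p.g q.hr := SemiPair.dom_comp p q e
  have hc : p.hr.left = (α.restrict.act p.g q.hr hd).right :=
    WideSubcategory.ext (SemiPair.h_comp p q e)
  rw [crossedS, crossedS, crossedS, term_mul_term (SemiPair.g_comp p q e), hom_S _ _ hd,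
    CatCStar.isCatRep_S.mul_of_comp _ _ hc, mul_hr p q e hd hc]
  rfl

theorem crossedS_mul_of_ne (p q : α.SemiPair) (e : p.src ≠ q.tgt) :
    crossedS p * crossedS q = 0 := by
  by_cases h : p.g.left = q.g.right
  · have hd : α.restrict.Dom p.g q.hr := ⟨h.trans q.φ_right, q.φ_right.symm.trans q.φ_left⟩
    rw [crossedS, crossedS, term_mul_term h, hom_S _ _ hd,
      CatCStar.isCatRep_S.mul_of_not_comp, map_zero]
    intro hc
    apply e
    have h1 : p.h.left = α.actUnit p.g q.h.right hd.1 :=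
      (congrArg WideSubcategory.obj hc).trans (act_right_eq (h := q.h) hd)
    have h2 : p.g.right = α.φ (α.actUnit p.g q.h.right hd.1) := p.φ_left.trans (congrArg _ h1)
    exact (actUnit_congr h1 p.φ_left h2).trans (actUnit_inv_actUnit (α := α) hd.1 h2)
  · exact term_mul_term_of_ne h _ _

/-- The final projection of `S_h g` is that of `S_h`, placed at the unit `t(g)`. -/
theorem crossedS_mul_star (p : α.SemiPair) :
    crossedS p * star (crossedS p) =
      α.β.unitHom p.g.right (CatCStar.S p.hr * star (CatCStar.S p.hr)) :=
  term_mul_star_term _ _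

/-- The initial projection of `S_h g` is that of `S_{α_{g⁻¹}(h)}`, placed at the unit `s(g)`. -/
theorem star_crossedS_mul (p : α.SemiPair) :
    star (crossedS p) * crossedS p =
      α.β.unitHom p.g.left (star (CatCStar.S (α.restrict.act p.g.inv p.hr (dom_inv_hr p))) *
        CatCStar.S (α.restrict.act p.g.inv p.hr (dom_inv_hr p))) := by
  rw [crossedS, star_term_mul_term, hom_S _ _ (dom_inv_hr p)]

theorem isCatRep_crossedS : IsCatRep fun m : Mor α.SemiProd => crossedS m.hom.1 where
  partialIsometry m := by
    rw [crossedS_mul_star, crossedS, ← term_mul, CatCStar.isCatRep_S.partialIsometry]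
  mul_of_comp m n h := by
    rw [SemiPair.comp_hom, crossedS_mul]
  mul_of_not_comp m n h := crossedS_mul_of_ne _ _ fun e => h (by
    have : m.left.obj = n.right.obj := m.hom.2.1.symm.trans (e.trans n.hom.2.2)
    cases hm : m.left; cases hn : n.right
    rw [hm, hn] at this
    exact congrArg SemiProd.mk this)
  commute_initial m n := by
    rw [star_crossedS_mul, star_crossedS_mul]
    exact commute_unitHom _ _ (CatCStar.isCatRep_S.commute_initial _ _)
  commute_final m n := by
    rw [crossedS_mul_star, crossedS_mul_star]
    exact commute_unitHom _ _ (CatCStar.isCatRep_S.commute_final _ _)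
  commute_initial_final m n := by
    rw [star_crossedS_mul, crossedS_mul_star]
    exact commute_unitHom _ _ (CatCStar.isCatRep_S.commute_initial_final _ _)
  disjoint m n h := by
    rw [crossedS_mul_star, crossedS_mul_star]
    by_cases e : m.hom.1.g.right = n.hom.1.g.right
    · rw [e, ← map_mul, CatCStar.isCatRep_S.disjoint _ _ ?_, map_zero]
      rintro ⟨k, hk, hk'⟩
      have hφ : m.hom.1.g.right = α.φ k.right.obj := by
        obtain ⟨l, hl, rfl⟩ := hk
        exact m.hom.1.φ_right
      have hφ' : n.hom.1.g.right = α.φ k.right.obj := e.symm.trans hφ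
      have d1 := divides_toMor hk hφ
      have d2 := divides_toMor hk' hφ'
      rw [SemiPair.toMor_hom] at d1 d2
      refine h ⟨_, d1, ?_⟩
      convert d2 using 4
    · exact unitHom_mul_of_ne e _ _
  initial_mul_final m n h := by
    have e : m.hom.1.src = n.hom.1.tgt :=
      m.hom.2.1.trans ((congrArg SemiProd.obj h).trans n.hom.2.2.symm)
    have hg : m.hom.1.g.left = n.hom.1.g.right := SemiPair.g_comp _ _ e
    rw [star_crossedS_mul, crossedS_mul_star, hg, ← map_mul, CatCStar.isCatRep_S.initial_mul_final]
    refine WideSubcategory.ext ?_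
    refine Eq.trans ?_ e
    rw [SemiPair.src_eq]
    rfl

/-- The *-homomorphism `C*(H ×_α G) → C*(H_r) ×_α̃ G` with `S_{(h, g)} ↦ S_h g`. -/
noncomputable def toCrossedProduct (α : CatAction G H) :
    CatCStar α.SemiProd →⋆ₙₐ[ℂ] α.β.CrossedProduct :=
  CatCStar.lift _ isCatRep_crossedS

theorem toCrossedProduct_S (p : α.SemiPair) : α.toCrossedProduct p.S = crossedS p :=
  CatCStar.lift_S _ isCatRep_crossedS p.toMor

theorem isCovariant_π_V : IsCovariant α.β α.π α.V where
  mul_of_comp := V_mul_V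
  mul_of_not_comp := V_mul_V_of_ne
  star_eq := star_V
  covariant := V_mul_π

/-- Followed by the integrated form of `(π, V)`, the map becomes the inclusion of `C*(H ×_α G)` in its
multiplier algebra. -/
theorem isometry_toCrossedProduct : Isometry α.toCrossedProduct := by
  have key : isCovariant_π_V.lift.comp α.toCrossedProduct = toMult (CatCStar α.SemiProd) := by
    refine CatCStar.hom_ext fun m => ?_
    rw [← SemiPair.toMor_hom m, NonUnitalStarAlgHom.comp_apply]
    change isCovariant_π_V.lift (α.toCrossedProduct m.hom.1.S) = _
    rw [toCrossedProduct_S, crossedS_eq, IsCovariant.lift_mono, π_S_mul_V _ _ m.hom.1.φ_right]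
    rfl
  refine NonUnitalStarAlgHom.isometry _ fun x y h => toMult_injective ?_
  rw [← key, NonUnitalStarAlgHom.comp_apply, NonUnitalStarAlgHom.comp_apply, h]

theorem isClosed_range_toCrossedProduct :
    IsClosed (Set.range α.toCrossedProduct) :=
  isometry_toCrossedProduct.isClosedEmbedding.isClosed_range

theorem term_S_mem_range (g : Mor G) (h : Mor α.Reg) :
    α.β.term g (CatCStar.S h) ∈ NonUnitalStarAlgHom.range α.toCrossedProduct := by
  by_cases hg : g.right = α.φ h.right.obj
  · exact ⟨(pairOf h g hg).S, toCrossedProduct_S _⟩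
  · have h0 : α.β.hom (Mor.unit g.right) (CatCStar.S h) = 0 :=
      indHom_S_of_not α.restrict_isRegular fun hd => hg hd.1
    have : α.β.term g (CatCStar.S h) = α.β.term g 0 := term_congr rfl (by rw [h0, map_zero])
    rw [this, map_zero]
    exact zero_mem _

theorem unitHom_mem_range (x : G) (a : CatCStar α.Reg) :
    α.β.unitHom x a ∈ NonUnitalStarAlgHom.range α.toCrossedProduct :=
  CatCStar.mem_of_closed
    ((NonUnitalStarAlgHom.range α.toCrossedProduct).comap (α.β.unitHom x))
    (isClosed_range_toCrossedProduct.preimage (map_continuous (α.β.unitHom x)))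
    (fun h => term_S_mem_range (Mor.unit x) h) a

/-- The range contains all `a g`: as it contains the coefficients at the units, the set of those `a`
for which it contains `a g` and `a* g` is a closed *-subalgebra. -/
theorem term_mem_range (g : Mor G) (a : CatCStar α.Reg) :
    α.β.term g a ∈ NonUnitalStarAlgHom.range α.toCrossedProduct := by
  set R := NonUnitalStarAlgHom.range α.toCrossedProduct
  have hR : IsClosed (R : Set α.β.CrossedProduct) := isClosed_range_toCrossedProduct
  have hmul : ∀ a b, α.β.term g b ∈ R → α.β.term g (a * b) ∈ R := fun a b hb => by
    rw [term_mul]; exact mul_mem (unitHom_mem_range _ a) hb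
  let K : NonUnitalStarSubalgebra ℂ (CatCStar α.Reg) :=
    { carrier := {a | α.β.term g a ∈ R ∧ α.β.term g (star a) ∈ R}
      add_mem' := fun {a b} ha hb => by
        simp only [Set.mem_ofPred_eq, star_add, map_add]
        exact ⟨add_mem ha.1 hb.1, add_mem ha.2 hb.2⟩
      zero_mem' := by
        simp only [Set.mem_ofPred_eq, star_zero, map_zero, and_self]
        exact zero_mem R
      mul_mem' := fun {a b} ha hb => by
        refine ⟨hmul a b hb.1, ?_⟩
        rw [star_mul]
        exact hmul _ _ ha.2
      smul_mem' := fun c a ha => by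
        simp only [Set.mem_ofPred_eq, star_smul, map_smul]
        exact ⟨SMulMemClass.smul_mem c ha.1, SMulMemClass.smul_mem (star c) ha.2⟩
      star_mem' := fun {a} ha => by
        simp only [Set.mem_ofPred_eq, star_star]
        exact ha.symm }
  have hK : IsClosed (K : Set (CatCStar α.Reg)) :=
    (hR.preimage (continuous_term g)).inter
      (hR.preimage ((continuous_term g).comp continuous_star))
  refine (CatCStar.mem_of_closed K hK (fun h => ⟨term_S_mem_range g h, ?_⟩) a).1
  rw [← CatCStar.isCatRep_S.star_mul_unit h]
  exact hmul _ _ (term_S_mem_range g _)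

theorem surjective_toCrossedProduct : Function.Surjective α.toCrossedProduct := by
  have h : ∀ f, α.β.crossedNorm.incl f ∈ Set.range α.toCrossedProduct := fun f => by
    change α.β.toCrossed f ∈ NonUnitalStarAlgHom.range α.toCrossedProduct
    induction f using QuasiAction.Alg.ind with
    | zero => rw [map_zero]; exact zero_mem _
    | add f g hf hg => rw [map_add]; exact add_mem hf hg
    | mono t a ha => rw [← term_eq ha]; exact term_mem_range t a
  exact CStarSeminorm.compl_induction₁ (p := α.β.crossedNorm) isClosed_range_toCrossedProduct h

end CatAction

theorem mainTheorem1 {G : Type u₁} [Groupoid.{v₁} G] {H : Type u₂} [Category.{v₂} H]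
    (α : CatAction G H) :
    ∃ Φ : CatCStar α.SemiProd ≃⋆ₐ[ℂ]
        (CatAction.quasiAction α.restrict_isRegular).CrossedProduct,
      ∀ p : α.SemiPair, Φ (CatCStar.S p.toMor) =
        (CatAction.quasiAction α.restrict_isRegular).toCrossed
          (QuasiAction.Alg.mono p.g (CatCStar.S p.hr) p.S_hr_mem) :=
  ⟨StarAlgEquiv.ofBijective α.toCrossedProduct
      ⟨CatAction.isometry_toCrossedProduct.injective, CatAction.surjective_toCrossedProduct⟩,
    fun p => (CatAction.toCrossedProduct_S p).trans (CatAction.crossedS_eq p)⟩
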